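/- Conventions. Let $(\Omega,\mathcal A,\mathbb P)$ be a probability space and $d\in\mathbb N$. A *real measure* over a Borel set $D$ is a real-valued function that is $\sigma$-additive on the bounded Borel subsets of $D$; its total variation is $|\mu|(A)=\sup\sum_j|\mu(I_j)|$ over finite Borel partitions $(I_j)$ of $A$. A *random measure* over $D\subseteq\mathbb R^d$ is a function $N$ from the bounded Borel subsets of $D$ to $L^2(\Omega,\mathcal A,\mathbb P)$ that is $\sigma$-additive and for which there is a real measure $C_N$ over $D\times D$ (the covariance measure) with $C_N(A\times B)=\mathrm{Cov}(N(A),N(B))$; its mean measure is $A\mapsto\mathbb E(N(A))$. A *Riemann system* of a bounded Borel set $A$ is a sequence, indexed by $n$, of finite Borel partitions $(I^n_j)_{j\in J_n}$ of $A$ with tags $x^n_j\in I^n_j$ and $\max_j\mathrm{diam}(I^n_j)\to0$. A kernel $K:\mathbb R^d\times\mathcal B_B(\mathbb R^d)\to\mathbb R$ ($\mathcal B_B$ denoting the bounded Borel sets) is *self-integrable* over $A$ if there is a unique $\ell\in\mathbb R$ with $\lim_n\sum_{j}K(x^n_j,I^n_j)=\ell$ for every Riemann system of $A$; then $\int_AK(x,dx):=\ell$.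 If each $K(x,\cdot)$ is a real measure, put $K^{(2)}((x,y),E)=(K(y,\cdot)\otimes K(x,\cdot))(E)$ for bounded Borel $E\subset\mathbb R^d\times\mathbb R^d$. A kernel $H:(\mathbb R^d\times\mathbb R^d)\times\mathcal B_B(\mathbb R^d\times\mathbb R^d)\to\mathbb R$ is *quasi-self-integrable* over $A\times B$ if there is $\ell\in\mathbb R$ such that $\lim_{(n,m)\to\infty}\sum_j\sum_kH((a^n_j,b^m_k),A^n_j\times B^m_k)=\ell$ for all Riemann systems $(A^n_j,a^n_j)$ of $A$ and $(B^m_k,b^m_k)$ of $B$; then $\widetilde\int_{A\times B}H(x,dx):=\ell$. Write $|K|(x,A)=|K(x,\cdot)|(A)$, and likewise for $|K^{(2)}|$. Statement. Let $Z$ be a centred, second-order, mean-square continuous real process over $\mathbb R^d$ and $M$ a centred random measure over $\mathbb R^d$ with covariance measure $C_M$, such that $Z$ and $M$ are jointly Gaussian (all vectors $(Z(x_1),\dots,Z(x_n),M(A_1),\dots,M(A_m))$ are Gaussian, the $A_i$ being bounded Borel sets). Put $C_Z(x,y)=\mathrm{Cov}(Z(x),Z(y))$ and $K_{Z,M}(x,A)=\mathrm{Cov}(Z(x),M(A))$.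 Let $D\subset\mathbb R^d$ be compact. Suppose that $K_{Z,M}$ and $|K_{Z,M}|$ are self-integrable over $D$ and that $K_{Z,M}^{(2)}$ and $|K_{Z,M}^{(2)}|$ are quasi-self-integrable over $D\times D$. Then for every Borel $A\subseteq D$ the stochastic integral $\int_AZ\,dM$ is uniquely defined, that is, the Riemann sums $\sum_jZ(x^n_j)M(I^n_j)$ converge in $L^2(\Omega,\mathcal A,\mathbb P)$ to one and the same random variable $\int_AZ\,dM$ for all Riemann systems of $A$; the function $A\mapsto\int_AZ\,dM$ is a random measure over $D$; and for all Borel $A,B\subseteq D$, $K_{Z,M}$ is self-integrable over $A$, $K_{Z,M}^{(2)}$ is quasi-self-integrable over $A\times B$, and $$\mathbb E\Big(\int_AZ\,dM\Big)=\int_AK_{Z,M}(x,dx),\qquad \mathrm{Cov}\Big(\int_AZ\,dM,\int_BZ\,dM\Big)=\int_{A\times B}C_Z\,dC_M+\widetilde\int_{A\times B}K_{Z,M}^{(2)}(x,dx).$$ -/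

import Mathlib

open MeasureTheory ProbabilityTheory Filter Set Bornology
open scoped Topology ENNReal Function

noncomputable section

namespace SelfIntegral

/-! ### Real measures on the bounded Borel sets -/

/-- A real measure over `D`: a real function, σ-additive on the bounded measurable subsets of `D`
(its values on other sets are irrelevant). -/
structure RealMeasureOn {X : Type*} [MeasurableSpace X] [Bornology X] (D : Set X) where
  toFun : Set X → ℝ
  hasSum_iUnion' : ∀ A : ℕ → Set X, (∀ i, MeasurableSet (A i)) → Pairwise (Disjoint on A) →
    IsBounded (⋃ i, A i) → (⋃ i, A i) ⊆ D → HasSum (fun i => toFun (A i)) (toFun (⋃ i, A i))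

namespace RealMeasureOn

variable {X Y : Type*} [MeasurableSpace X] [Bornology X] [MeasurableSpace Y] [Bornology Y]

instance (D : Set X) : CoeFun (RealMeasureOn D) (fun _ => Set X → ℝ) := ⟨toFun⟩

theorem apply_empty {D : Set X} (μ : RealMeasureOn D) : μ ∅ = 0 := by
  have h := μ.hasSum_iUnion' (fun _ => ∅) (fun _ => MeasurableSet.empty)
    (fun i j _ => disjoint_bot_left) (by simp) (by simp)
  have h2 := h.summable.tendsto_atTop_zero
  simpa using tendsto_nhds_unique tendsto_const_nhds h2

open Classical in
/-- The finite signed measure `S ↦ μ (S ∩ A)`, for a bounded measurable `A ⊆ D`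
(and `0` for other `A`). -/
def window {D : Set X} (μ : RealMeasureOn D) (A : Set X) : SignedMeasure X :=
  if h : MeasurableSet A ∧ IsBounded A ∧ A ⊆ D then
    { measureOf' := fun S => if MeasurableSet S then μ (S ∩ A) else 0
      empty' := by simp [μ.apply_empty]
      not_measurable' := fun S hS => by simp [hS]
      m_iUnion' := fun f hf hd => by
        have := μ.hasSum_iUnion' (fun i => f i ∩ A) (fun i => (hf i).inter h.1)
          (fun i j hij => (hd hij).mono inter_subset_left inter_subset_left)
          (h.2.1.subset (iUnion_subset fun i => inter_subset_right))
          ((iUnion_subset fun i => inter_subset_right).trans h.2.2)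
        simpa [hf, MeasurableSet.iUnion hf, iUnion_inter] using this }
  else 0

/-- The integral `∫_A f dμ` over a bounded measurable set `A ⊆ D`. -/
def integralOver {D : Set X} (μ : RealMeasureOn D) (A : Set X) (f : X → ℝ) : ℝ :=
  ∫ᵛ x, f x ∂•(μ.window A)

/-- The product `μ ⊗ ν` of two real measures, evaluated at a bounded measurable set `S`: the two
factors are first restricted to bounded closed sets whose product contains `S`. -/
def prod [TopologicalSpace X] [TopologicalSpace Y] (μ : RealMeasureOn (univ : Set X))
    (ν : RealMeasureOn (univ : Set Y)) (S : Set (X × Y)) : ℝ :=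
  (μ.window (closure (Prod.fst '' S))).prod (ν.window (closure (Prod.snd '' S)))
    (ContinuousLinearMap.mul ℝ ℝ) S

end RealMeasureOn

/-- The total variation of a set function on `A`: the supremum of `∑ j, |μ (I j)|` over the finite
measurable partitions `I` of `A`. -/
def totalVariation {X : Type*} [MeasurableSpace X] (μ : Set X → ℝ) (A : Set X) : ℝ :=
  sSup {s : ℝ | ∃ (n : ℕ) (I : Fin n → Set X), (∀ j, MeasurableSet (I j)) ∧
    Pairwise (Disjoint on I) ∧ (⋃ j, I j) = A ∧ s = ∑ j, |μ (I j)|}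

/-- The total-variation kernel `|K|(x, A) = |K(x, ·)|(A)`. -/
def tvKernel {X Y : Type*} [MeasurableSpace Y] (K : X → Set Y → ℝ) : X → Set Y → ℝ :=
  fun x A => totalVariation (K x) A

/-- The second-order kernel `K⁽²⁾((x, y), S) = (K(y, ·) ⊗ K(x, ·))(S)`. -/
def secondOrderKernel {X Y : Type*} [MeasurableSpace Y] [Bornology Y] [TopologicalSpace Y]
    (K : X → RealMeasureOn (univ : Set Y)) : X × X → Set (Y × Y) → ℝ :=
  fun p S => (K p.2).prod (K p.1) S

/-! ### Riemann systems and self-integrals -/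

/-- A Riemann system of `D`: a sequence of finite measurable partitions of `D` with mesh tending
to `0`, and a tag in every cell. (If `D` is infinite, the number of cells necessarily tends
to infinity; if `D` is finite, the cells are eventually singletons.) -/
structure RiemannSystem {X : Type*} [MeasurableSpace X] [PseudoEMetricSpace X] (D : Set X) where
  card : ℕ → ℕ
  cell : (n : ℕ) → Fin (card n) → Set X
  tag : (n : ℕ) → Fin (card n) → X
  measurableSet_cell : ∀ n j, MeasurableSet (cell n j)
  disjoint_cell : ∀ n, Pairwise (Disjoint on cell n)
  iUnion_cell : ∀ n, (⋃ j, cell n j) = D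
  tag_mem : ∀ n j, tag n j ∈ cell n j
  tendsto_mesh : Tendsto (fun n => ⨆ j, Metric.ediam (cell n j)) atTop (𝓝 0)

section Integrals

variable {X : Type*} [MeasurableSpace X] [PseudoEMetricSpace X]

/-- `ℓ` is the limit of the Riemann sums of `K` along every Riemann system of `D`. -/
def IsSelfIntegral (K : X → Set X → ℝ) (D : Set X) (l : ℝ) : Prop :=
  ∀ R : RiemannSystem D,
    Tendsto (fun n => ∑ j, K (R.tag n j) (R.cell n j)) atTop (𝓝 l)

/-- `K` is self-integrable over `D`. -/
def SelfIntegrable (K : X → Set X → ℝ) (D : Set X) : Prop :=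
  ∃! l : ℝ, IsSelfIntegral K D l

/-- `ℓ` is the double limit of the Riemann sums of the kernel `H` along every pair of Riemann
systems of `A` and of `B`. -/
def IsQuasiSelfIntegral (H : X × X → Set (X × X) → ℝ) (A B : Set X) (l : ℝ) : Prop :=
  ∀ (R : RiemannSystem A) (S : RiemannSystem B),
    Tendsto (fun q : ℕ × ℕ => ∑ j, ∑ k,
      H (R.tag q.1 j, S.tag q.2 k) (R.cell q.1 j ×ˢ S.cell q.2 k)) (atTop ×ˢ atTop) (𝓝 l)

/-- `H` is quasi-self-integrable over `A × B`. -/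
def QuasiSelfIntegrable (H : X × X → Set (X × X) → ℝ) (A B : Set X) : Prop :=
  ∃ l : ℝ, IsQuasiSelfIntegral H A B l

end Integrals

/-! ### Mean-square continuous processes and random measures -/

/-- A second-order, mean-square continuous real process indexed by `X`. -/
structure MSProcess {Ω : Type*} [MeasurableSpace Ω] (P : Measure Ω) (X : Type*)
    [TopologicalSpace X] where
  toFun : X → Ω → ℝ
  memLp : ∀ x, MemLp (toFun x) 2 P
  tendsto_L2 : ∀ x₀, Tendsto (fun x => eLpNorm (toFun x - toFun x₀) 2 P) (𝓝 x₀) (𝓝 0)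

/-- A random measure over `D`: an `L²`-valued function, σ-additive on the bounded measurable
subsets of `D`, whose covariance structure is a real measure `cov` over `D × D`. -/
structure RandomMeasure {Ω : Type*} [MeasurableSpace Ω] (P : Measure Ω) {X : Type*}
    [MeasurableSpace X] [Bornology X] (D : Set X) where
  toFun : Set X → Lp ℝ 2 P
  hasSum_iUnion' : ∀ A : ℕ → Set X, (∀ i, MeasurableSet (A i)) → Pairwise (Disjoint on A) →
    IsBounded (⋃ i, A i) → (⋃ i, A i) ⊆ D → HasSum (fun i => toFun (A i)) (toFun (⋃ i, A i))
  cov : RealMeasureOn (D ×ˢ D)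
  cov_prod : ∀ A B : Set X, MeasurableSet A → IsBounded A → A ⊆ D →
    MeasurableSet B → IsBounded B → B ⊆ D → cov (A ×ˢ B) = cov[toFun A, toFun B; P]

section Stochastic

variable {Ω : Type*} [MeasurableSpace Ω] {P : Measure Ω}

instance {X : Type*} [TopologicalSpace X] : CoeFun (MSProcess P X) (fun _ => X → Ω → ℝ) :=
  ⟨MSProcess.toFun⟩

instance {X : Type*} [MeasurableSpace X] [Bornology X] (D : Set X) :
    CoeFun (RandomMeasure P D) (fun _ => Set X → Lp ℝ 2 P) :=
  ⟨RandomMeasure.toFun⟩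

theorem integral_L2_eq_inner [IsProbabilityMeasure P] (f : Lp ℝ 2 P) :
    ∫ ω, f ω ∂P = inner ℝ ((memLp_const (1 : ℝ)).toLp (fun _ : Ω => (1 : ℝ)) : Lp ℝ 2 P) f := by
  rw [L2.inner_def]
  refine integral_congr_ae ?_
  filter_upwards with ω
  simp

theorem covariance_L2_eq_inner [IsProbabilityMeasure P] {g : Ω → ℝ} (hg : MemLp g 2 P)
    (f : Lp ℝ 2 P) :
    cov[g, f; P] = inner ℝ (hg.toLp g) f - (∫ ω, g ω ∂P) * ∫ ω, f ω ∂P := by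
  rw [covariance_eq_sub hg (Lp.memLp f), L2.inner_def]
  congr 1
  refine integral_congr_ae ?_
  filter_upwards [hg.coeFn_toLp] with ω h
  simp [h, mul_comm]

/-- The mean measure `A ↦ E[M(A)]`. -/
def RandomMeasure.mean [IsProbabilityMeasure P] {X : Type*} [MeasurableSpace X] [Bornology X]
    {D : Set X} (M : RandomMeasure P D) : RealMeasureOn D where
  toFun A := ∫ ω, M A ω ∂P
  hasSum_iUnion' A hA hd hb hD := by
    simp only [integral_L2_eq_inner]
    exact (M.hasSum_iUnion' A hA hd hb hD).mapL (innerSL ℝ _)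

/-- The cross-covariance kernel `K_{Z,M}(x, A) = Cov(Z(x), M(A))`. -/
def crossCov [IsProbabilityMeasure P] {X Y : Type*} [TopologicalSpace X] [MeasurableSpace Y]
    [Bornology Y] (Z : MSProcess P X) (M : RandomMeasure P (univ : Set Y)) (x : X) :
    RealMeasureOn (univ : Set Y) where
  toFun A := cov[Z x, M A; P]
  hasSum_iUnion' A hA hd hb hD := by
    simp only [covariance_L2_eq_inner (Z.memLp x)]
    exact ((M.hasSum_iUnion' A hA hd hb hD).mapL (innerSL ℝ _)).sub
      ((M.mean.hasSum_iUnion' A hA hd hb hD).mul_left _)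

/-- `Z` and `M` are jointly Gaussian: all the vectors
`(Z(x₁), …, Z(xₙ), M(A₁), …, M(Aₘ))` with bounded measurable `Aⱼ` are Gaussian. -/
def JointlyGaussian {X Y : Type*} [TopologicalSpace X] [MeasurableSpace Y] [Bornology Y]
    (Z : MSProcess P X) (M : RandomMeasure P (univ : Set Y)) : Prop :=
  IsGaussianProcess
    (Sum.elim (fun x : X => Z x)
      (fun A : {A : Set Y // MeasurableSet A ∧ IsBounded A} => ⇑(M A.1))) P

/-- `I` is the stochastic integral `∫_D Z dM`, uniquely defined in the `L²` sense: the Riemann sums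
converge to `I` in `L²` along every Riemann system of `D`. -/
def IsStochasticIntegral {X : Type*} [MeasurableSpace X] [PseudoMetricSpace X]
    (Z : MSProcess P X) (M : RandomMeasure P (univ : Set X)) (D : Set X) (I : Lp ℝ 2 P) : Prop :=
  ∀ R : RiemannSystem D,
    Tendsto (fun n => eLpNorm
      (fun ω => ∑ j, Z (R.tag n j) ω * M (R.cell n j) ω - I ω) 2 P) atTop (𝓝 0)

end Stochastic

end SelfIntegral

end

noncomputable section

namespace SelfIntegral

/-! ### Fourth moments of centred Gaussian vectors. -/

section Gaussian

variable {Ω : Type*} [MeasurableSpace Ω] {P : Measure Ω}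

/-! Write K for the cross-covariance kernel. Isserlis' formula (`inner_productL2`) gives the L²
inner product of Z(x)M(I) and Z(y)M(J) as K(x,I)K(y,J) + C_Z(x,y)C_M(I×J) + K(y,I)K(x,J). The inner
product of a stochastic Riemann sum over A with one over B is therefore a sum of three deterministic
double sums. If these converge, Loève's criterion (`exists_tendsto_of_tendsto_inner`) makes the
stochastic sums converge, and the limits give the covariance.

The first double sum is a product of Riemann sums of K. Self-integrability passes from D to
measurable subsets by completing two partitions of A with the same partition of D \ A. The
approximation is uniform over subsets (`exists_mesh_forall_dist_selfIntegral_le`), which makes the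
self-integral σ-additive (`tendsto_selfIntegral_diff_biUnion`). The second double sum is a Riemann
sum of a continuous function against a finite signed measure.

For the third, let ν be the sum of the marginals of |C_M| over D × D. Since C_M(A×B) is the inner
product of M(A) and M(B), the L²(ν) norm dominates integration against M. By duality K(x,·) has on D
a density g_x in L²(ν), which depends continuously on x (`exists_density_of_inner_eq`). With x(u)
and y(v) the tags of the cells of u and v, the double sum is the integral of g_{x(u)}(v) g_{y(v)}(u)
over A × B. The step kernels g_{x(u)}(v) converge in L²(ν⊗ν) to a kernel κ, so the limit is the
integral of κ(u,v)κ(v,u) over A × B.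

The second and third limits are thus values of measures on D × D, whose sum is the covariance
measure of the integral. The squared norm of the integral over a vanishing tail tends to 0, which
gives σ-additivity in L². -/

theorem iteratedDeriv_four_exp_sq (v : ℝ) :
    iteratedDeriv 4 (fun t : ℝ => Real.exp (v * t ^ 2 / 2)) 0 = 3 * v ^ 2 := by
  have hexp : ∀ t : ℝ, HasDerivAt (fun t : ℝ => Real.exp (v * t ^ 2 / 2))
      (Real.exp (v * t ^ 2 / 2) * (v * t)) t := fun t => by
    have h := (((hasDerivAt_pow 2 t).const_mul v).div_const 2).exp
    convert h using 1
    norm_num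
    ring
  have h1 : deriv (fun t : ℝ => Real.exp (v * t ^ 2 / 2))
      = fun t => Real.exp (v * t ^ 2 / 2) * (v * t) := funext fun t => (hexp t).deriv
  have h2 : deriv (fun t : ℝ => Real.exp (v * t ^ 2 / 2) * (v * t))
      = fun t => Real.exp (v * t ^ 2 / 2) * (v + v ^ 2 * t ^ 2) := funext fun t => by
    have h := (hexp t).mul ((hasDerivAt_id t).const_mul v)
    refine (h.congr_deriv ?_).deriv
    simp
    ring
  have h3 : deriv (fun t : ℝ => Real.exp (v * t ^ 2 / 2) * (v + v ^ 2 * t ^ 2))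
      = fun t => Real.exp (v * t ^ 2 / 2) * (3 * v ^ 2 * t + v ^ 3 * t ^ 3) := funext fun t => by
    have h := (hexp t).mul ((((hasDerivAt_id t).pow 2).const_mul (v ^ 2)).const_add v)
    refine (h.congr_deriv ?_).deriv
    simp
    ring
  have h4 : deriv (fun t : ℝ => Real.exp (v * t ^ 2 / 2) * (3 * v ^ 2 * t + v ^ 3 * t ^ 3)) 0
      = 3 * v ^ 2 := by
    have h := (hexp 0).mul (((hasDerivAt_id (0 : ℝ)).const_mul (3 * v ^ 2)).add
      (((hasDerivAt_id (0 : ℝ)).pow 3).const_mul (v ^ 3)))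
    refine (h.congr_deriv ?_).deriv
    simp
  rw [iteratedDeriv_succ, iteratedDeriv_succ, iteratedDeriv_succ, iteratedDeriv_one, h1, h2, h3, h4]

/-- The fourth moment is the fourth derivative at 0 of the moment generating function exp(vt²/2). -/
theorem integral_pow_four_gaussianReal (v : NNReal) :
    ∫ x, x ^ 4 ∂(gaussianReal 0 v) = 3 * (v : ℝ) ^ 2 := by
  have h := iteratedDeriv_mgf_zero (X := id) (μ := gaussianReal 0 v)
    (by simp [integrableExpSet_id_gaussianReal]) 4
  rw [mgf_id_gaussianReal] at h
  simp only [zero_mul, zero_add] at h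
  rw [iteratedDeriv_four_exp_sq] at h
  simpa using h.symm

theorem integral_pow_four_of_hasGaussianLaw {Y : Ω → ℝ} (hY : HasGaussianLaw Y P)
    (h0 : ∫ ω, Y ω ∂P = 0) : ∫ ω, Y ω ^ 4 ∂P = 3 * (∫ ω, Y ω ^ 2 ∂P) ^ 2 := by
  have hm := hY.aemeasurable
  have hv : Var[Y; P] = ∫ ω, Y ω ^ 2 ∂P := variance_of_integral_eq_zero hm h0
  have hl := hY.map_eq_gaussianReal
  rw [h0] at hl
  have h4 := integral_pow_four_gaussianReal Var[Y; P].toNNReal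
  rw [← hl, integral_map hm (by fun_prop), Real.coe_toNNReal _ (variance_nonneg _ _), hv] at h4
  exact h4

variable {T : Type*} {X : T → Ω → ℝ}

theorem memLp_mul_of_isGaussianProcess (hX : IsGaussianProcess X P) (a b : T) :
    MemLp (fun ω => X a ω * X b ω) 2 P := by
  have h4 : ∀ t, MemLp (X t) 4 P := fun t => (hX.hasGaussianLaw_eval t).memLp (by norm_num)
  have : ENNReal.HolderTriple 4 4 2 := ⟨by
    rw [← two_mul, show (4 : ℝ≥0∞) = 2 * 2 by norm_num,
      ENNReal.mul_inv (by norm_num) (by norm_num), ← mul_assoc,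
      ENNReal.mul_inv_cancel (by norm_num) (by norm_num), one_mul]⟩
  exact (h4 b).mul (h4 a)

/-- Isserlis' formula for four jointly Gaussian centred variables. -/
theorem integral_mul_four_of_isGaussianProcess (hX : IsGaussianProcess X P)
    (h0 : ∀ t, ∫ ω, X t ω ∂P = 0) (a b c d : T) :
    ∫ ω, (X a ω * X b ω) * (X c ω * X d ω) ∂P =
      (∫ ω, X a ω * X b ω ∂P) * (∫ ω, X c ω * X d ω ∂P)
      + (∫ ω, X a ω * X c ω ∂P) * (∫ ω, X b ω * X d ω ∂P)
      + (∫ ω, X a ω * X d ω ∂P) * (∫ ω, X b ω * X c ω ∂P) := by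
  have hL1 : ∀ t, Integrable (X t) P := fun t => (hX.hasGaussianLaw_eval t).integrable
  have := hX.isProbabilityMeasure
  have hI2 : ∀ s t, Integrable (fun ω => X s ω * X t ω) P := fun s t =>
    (memLp_mul_of_isGaussianProcess hX s t).integrable (by norm_num)
  have hlaw : ∀ w : Fin 4 → ℝ, HasGaussianLaw
      (fun ω => w 0 * X a ω + w 1 * X b ω + w 2 * X c ω + w 3 * X d ω) P := fun w => by
    have h := ((hX.comp_right ![a, b, c, d]).smul w).hasGaussianLaw_fun_sum (I := Finset.univ)
    simpa [Fin.sum_univ_four] using h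
  have hint : ∀ w : Fin 4 → ℝ, ∫ ω, w 0 * X a ω + w 1 * X b ω + w 2 * X c ω + w 3 * X d ω ∂P = 0 :=
    fun w => by
    rw [integral_add (by fun_prop) (by fun_prop), integral_add (by fun_prop) (by fun_prop),
      integral_add (by fun_prop) (by fun_prop)]
    simp [integral_const_mul, h0]
  have hsq : ∀ w : Fin 4 → ℝ,
      ∫ ω, (w 0 * X a ω + w 1 * X b ω + w 2 * X c ω + w 3 * X d ω) ^ 2 ∂P =
      w 0 ^ 2 * (∫ ω, X a ω * X a ω ∂P) + w 1 ^ 2 * (∫ ω, X b ω * X b ω ∂P)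
      + w 2 ^ 2 * (∫ ω, X c ω * X c ω ∂P) + w 3 ^ 2 * (∫ ω, X d ω * X d ω ∂P)
      + 2 * w 0 * w 1 * (∫ ω, X a ω * X b ω ∂P) + 2 * w 0 * w 2 * (∫ ω, X a ω * X c ω ∂P)
      + 2 * w 0 * w 3 * (∫ ω, X a ω * X d ω ∂P) + 2 * w 1 * w 2 * (∫ ω, X b ω * X c ω ∂P)
      + 2 * w 1 * w 3 * (∫ ω, X b ω * X d ω ∂P) + 2 * w 2 * w 3 * (∫ ω, X c ω * X d ω ∂P) :=
    fun w => by
    simp_rw [← integral_const_mul]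
    have hJ : ∀ (r : ℝ) s t, Integrable (fun ω => r * (X s ω * X t ω)) P :=
      fun r s t => (hI2 s t).const_mul r
    have h1 := fun r : ℝ => hJ r a a
    rw [← integral_add (by fun_prop) (by fun_prop), ← integral_add (by fun_prop) (by fun_prop),
      ← integral_add (by fun_prop) (by fun_prop), ← integral_add (by fun_prop) (by fun_prop),
      ← integral_add (by fun_prop) (by fun_prop), ← integral_add (by fun_prop) (by fun_prop),
      ← integral_add (by fun_prop) (by fun_prop), ← integral_add (by fun_prop) (by fun_prop),
      ← integral_add (by fun_prop) (by fun_prop)]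
    congr 1 with ω
    ring
  have h4 : ∀ w : Fin 4 → ℝ, _ := fun w => integral_pow_four_of_hasGaussianLaw (hlaw w) (hint w)
  have hI4 : ∀ w : Fin 4 → ℝ, Integrable
      (fun ω => (w 0 * X a ω + w 1 * X b ω + w 2 * X c ω + w 3 * X d ω) ^ 4) P := fun w =>
    ((hlaw w).memLp (p := 4) (by norm_num)).integrable_norm_pow (p := 4) (by norm_num) |>.congr
      (Eventually.of_forall fun ω => by simp [Even.pow_abs (show Even 4 by decide)])
  -- Polarization: summing the fourth powers of a ± b ± c ± d, weighted by the product of the signs,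
  -- leaves only the monomial abcd, with coefficient 8 · 4! = 192. Each of these combinations is a
  -- centred Gaussian, so its fourth moment is three times its squared variance.
  have key : ∫ ω, 192 * ((X a ω * X b ω) * (X c ω * X d ω)) ∂P = 
      (∫ ω, (1 * X a ω + 1 * X b ω + 1 * X c ω + 1 * X d ω) ^ 4 ∂P)
      - (∫ ω, (1 * X a ω + 1 * X b ω + 1 * X c ω + (-1) * X d ω) ^ 4 ∂P)
      - (∫ ω, (1 * X a ω + 1 * X b ω + (-1) * X c ω + 1 * X d ω) ^ 4 ∂P)
      + (∫ ω, (1 * X a ω + 1 * X b ω + (-1) * X c ω + (-1) * X d ω) ^ 4 ∂P)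
      - (∫ ω, (1 * X a ω + (-1) * X b ω + 1 * X c ω + 1 * X d ω) ^ 4 ∂P)
      + (∫ ω, (1 * X a ω + (-1) * X b ω + 1 * X c ω + (-1) * X d ω) ^ 4 ∂P)
      + (∫ ω, (1 * X a ω + (-1) * X b ω + (-1) * X c ω + 1 * X d ω) ^ 4 ∂P)
      - (∫ ω, (1 * X a ω + (-1) * X b ω + (-1) * X c ω + (-1) * X d ω) ^ 4 ∂P) := by
    have e := fun x y z : ℝ => hI4 ![1, x, y, z]
    simp only [Matrix.cons_val] at e
    rw [← integral_sub (by fun_prop) (by fun_prop), ← integral_sub (by fun_prop) (by fun_prop),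
      ← integral_add (by fun_prop) (by fun_prop), ← integral_sub (by fun_prop) (by fun_prop),
      ← integral_add (by fun_prop) (by fun_prop), ← integral_add (by fun_prop) (by fun_prop),
      ← integral_sub (by fun_prop) (by fun_prop)]
    congr 1 with ω
    ring
  have e4 := fun x y z : ℝ => h4 ![1, x, y, z]
  have es := fun x y z : ℝ => hsq ![1, x, y, z]
  simp only [Matrix.cons_val] at e4 es
  rw [integral_const_mul] at key
  simp only [e4, es] at key
  linear_combination key / 192

end Gaussian

/-! ### Tagged partitions and limits as the mesh tends to 0. -/

/-- A finite measurable partition of `A` with a tag in every cell. -/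
structure TaggedPartition {X : Type*} [MeasurableSpace X] (A : Set X) where
  card : ℕ
  cell : Fin card → Set X
  tag : Fin card → X
  measurableSet_cell : ∀ j, MeasurableSet (cell j)
  disjoint_cell : Pairwise (Disjoint on cell)
  iUnion_cell : (⋃ j, cell j) = A
  tag_mem : ∀ j, tag j ∈ cell j

namespace TaggedPartition

section Basic

variable {X : Type*} [MeasurableSpace X] {A B C : Set X}

theorem cell_subset (p : TaggedPartition A) (j : Fin p.card) : p.cell j ⊆ A :=
  (subset_iUnion p.cell j).trans p.iUnion_cell.subset

theorem tag_mem_set (p : TaggedPartition A) (j : Fin p.card) : p.tag j ∈ A :=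
  p.cell_subset j (p.tag_mem j)

/-- The Riemann sum of `F` along a tagged partition. -/
def sum {V : Type*} [AddCommMonoid V] (p : TaggedPartition A) (F : X → Set X → V) : V :=
  ∑ j, F (p.tag j) (p.cell j)

/-- A tagged partition with cells indexed by a finite type. -/
def ofFintype {ι : Type*} [Fintype ι] (cell : ι → Set X) (tag : ι → X)
    (hm : ∀ i, MeasurableSet (cell i)) (hd : Pairwise (Disjoint on cell))
    (hU : (⋃ i, cell i) = A) (ht : ∀ i, tag i ∈ cell i) : TaggedPartition A where
  card := Fintype.card ι
  cell j := cell ((Fintype.equivFin ι).symm j)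
  tag j := tag ((Fintype.equivFin ι).symm j)
  measurableSet_cell _ := hm _
  disjoint_cell _ _ hij := hd ((Fintype.equivFin ι).symm.injective.ne hij)
  iUnion_cell := by
    rw [← hU]
    exact (Fintype.equivFin ι).symm.surjective.iUnion_comp cell
  tag_mem _ := ht _

theorem sum_ofFintype {V : Type*} [AddCommMonoid V] {ι : Type*} [Fintype ι] (cell : ι → Set X)
    (tag : ι → X) (hm : ∀ i, MeasurableSet (cell i)) (hd : Pairwise (Disjoint on cell))
    (hU : (⋃ i, cell i) = A) (ht : ∀ i, tag i ∈ cell i) (F : X → Set X → V) :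
    (ofFintype cell tag hm hd hU ht).sum F = ∑ i, F (tag i) (cell i) :=
  (Fintype.equivFin ι).symm.sum_comp fun i => F (tag i) (cell i)

theorem pairwise_disjoint_sumElim (p : TaggedPartition A) (q : TaggedPartition B)
    (hAB : Disjoint A B) : Pairwise (Disjoint on Sum.elim p.cell q.cell) := by
  rintro (i | i) (j | j) hij
  · exact p.disjoint_cell fun h => hij (congrArg _ h)
  · exact hAB.mono (p.cell_subset i) (q.cell_subset j)
  · exact hAB.symm.mono (q.cell_subset i) (p.cell_subset j)
  · exact q.disjoint_cell fun h => hij (congrArg _ h)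

/-- The union of tagged partitions of two disjoint sets. -/
def union (p : TaggedPartition A) (q : TaggedPartition B) (hAB : Disjoint A B)
    (hC : A ∪ B = C) : TaggedPartition C :=
  ofFintype (Sum.elim p.cell q.cell) (Sum.elim p.tag q.tag)
    (by rintro (i | i); exacts [p.measurableSet_cell i, q.measurableSet_cell i])
    (p.pairwise_disjoint_sumElim q hAB)
    (by simp [iUnion_sum, p.iUnion_cell, q.iUnion_cell, hC])
    (by rintro (i | i); exacts [p.tag_mem i, q.tag_mem i])

theorem sum_union {V : Type*} [AddCommMonoid V] (p : TaggedPartition A) (q : TaggedPartition B)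
    (hAB : Disjoint A B) (hC : A ∪ B = C) (F : X → Set X → V) :
    (p.union q hAB hC).sum F = p.sum F + q.sum F := by
  rw [union, sum_ofFintype, Fintype.sum_sum_type]
  rfl

/-- Removal from all the cells of a measurable set that contains no tag. -/
def diff (p : TaggedPartition A) (hB : MeasurableSet B) (ht : ∀ j, p.tag j ∉ B) :
    TaggedPartition (A \ B) where
  card := p.card
  cell j := p.cell j \ B
  tag := p.tag
  measurableSet_cell j := (p.measurableSet_cell j).diff hB
  disjoint_cell _ _ hij := (p.disjoint_cell hij).mono sdiff_subset sdiff_subset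
  iUnion_cell := by rw [← iUnion_sdiff, p.iUnion_cell]
  tag_mem j := ⟨p.tag_mem j, ht j⟩

end Basic

section Mesh

variable {X : Type*} [MeasurableSpace X] [PseudoEMetricSpace X] {A B C : Set X}

/-- The mesh of a tagged partition: the largest diameter of a cell. -/
def mesh (p : TaggedPartition A) : ℝ≥0∞ := ⨆ j, Metric.ediam (p.cell j)

theorem edist_tag_le (p : TaggedPartition A) {j : Fin p.card} {x : X} (hx : x ∈ p.cell j) :
    edist (p.tag j) x ≤ p.mesh :=
  (Metric.edist_le_ediam_of_mem (p.tag_mem j) hx).trans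
    (le_iSup (fun j => Metric.ediam (p.cell j)) j)

theorem mesh_ofFintype {ι : Type*} [Fintype ι] (cell : ι → Set X)
    (tag : ι → X) (hm : ∀ i, MeasurableSet (cell i)) (hd : Pairwise (Disjoint on cell))
    (hU : (⋃ i, cell i) = A) (ht : ∀ i, tag i ∈ cell i) :
    (ofFintype cell tag hm hd hU ht).mesh = ⨆ i, Metric.ediam (cell i) :=
  (Fintype.equivFin ι).symm.surjective.iSup_comp fun i => Metric.ediam (cell i)

theorem mesh_union (p : TaggedPartition A) (q : TaggedPartition B)
    (hAB : Disjoint A B) (hC : A ∪ B = C) : (p.union q hAB hC).mesh = p.mesh ⊔ q.mesh := by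
  rw [union, mesh_ofFintype, iSup_sum]
  rfl

theorem mesh_diff_le (p : TaggedPartition A) (hB : MeasurableSet B) (ht : ∀ j, p.tag j ∉ B) :
    (p.diff hB ht).mesh ≤ p.mesh :=
  iSup_mono fun _ => Metric.ediam_mono sdiff_subset

end Mesh

end TaggedPartition

section Fine

variable {X : Type*} [MeasurableSpace X] [PseudoEMetricSpace X] {A B C : Set X}

/-- The filter of arbitrarily fine tagged partitions of `A`. -/
def fine (A : Set X) : Filter (TaggedPartition A) := comap TaggedPartition.mesh (𝓝 0)

/-- Countable generation lets limits along this filter be tested on sequences, that is, on Riemann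
systems. -/
instance : (fine A).IsCountablyGenerated := by unfold fine; infer_instance

theorem tendsto_fine_iff {α : Type*} {l : Filter α} {f : α → TaggedPartition A} :
    Tendsto f l (fine A) ↔ Tendsto (fun a => (f a).mesh) l (𝓝 0) := tendsto_comap_iff

theorem eventually_fine_iff {Q : TaggedPartition A → Prop} :
    (∀ᶠ p in fine A, Q p) ↔ ∃ δ > 0, ∀ p : TaggedPartition A, p.mesh ≤ δ → Q p := by
  simpa [fine] using (ENNReal.nhds_zero_basis_Iic.comap TaggedPartition.mesh).eventually_iff

theorem eventually_mesh_le {δ : ℝ≥0∞} (hδ : 0 < δ) : ∀ᶠ p in fine A, p.mesh ≤ δ :=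
  eventually_fine_iff.2 ⟨δ, hδ, fun _ h => h⟩

theorem tendsto_union (hAB : Disjoint A B) (hC : A ∪ B = C) :
    Tendsto (fun pq : TaggedPartition A × TaggedPartition B => pq.1.union pq.2 hAB hC)
      (fine A ×ˢ fine B) (fine C) := by
  rw [tendsto_fine_iff]
  simp only [TaggedPartition.mesh_union]
  have h1 : Tendsto (fun pq : TaggedPartition A × TaggedPartition B => pq.1.mesh)
    (fine A ×ˢ fine B) (𝓝 0) := tendsto_fine_iff.1 tendsto_fst
  have h2 : Tendsto (fun pq : TaggedPartition A × TaggedPartition B => pq.2.mesh)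
    (fine A ×ˢ fine B) (𝓝 0) := tendsto_fine_iff.1 tendsto_snd
  simpa using h1.sup_nhds h2

/-- The tagged partitions of a Riemann system. -/
def RiemannSystem.partition (R : RiemannSystem A) (n : ℕ) : TaggedPartition A where
  card := R.card n
  cell := R.cell n
  tag := R.tag n
  measurableSet_cell := R.measurableSet_cell n
  disjoint_cell := R.disjoint_cell n
  iUnion_cell := R.iUnion_cell n
  tag_mem := R.tag_mem n

theorem RiemannSystem.tendsto_partition (R : RiemannSystem A) :
    Tendsto R.partition atTop (fine A) :=
  tendsto_fine_iff.2 R.tendsto_mesh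

/-- The Riemann system of a sequence of finer and finer tagged partitions. -/
def RiemannSystem.ofSeq (p : ℕ → TaggedPartition A) (hp : Tendsto p atTop (fine A)) :
    RiemannSystem A where
  card n := (p n).card
  cell n := (p n).cell
  tag n := (p n).tag
  measurableSet_cell n := (p n).measurableSet_cell
  disjoint_cell n := (p n).disjoint_cell
  iUnion_cell n := (p n).iUnion_cell
  tag_mem n := (p n).tag_mem
  tendsto_mesh := tendsto_fine_iff.1 hp

theorem nonempty_riemannSystem (A : Set X) [(fine A).NeBot] : Nonempty (RiemannSystem A) :=
  let ⟨p, hp⟩ := exists_seq_tendsto (fine A)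
  ⟨RiemannSystem.ofSeq p hp⟩

theorem isSelfIntegral_iff {K : X → Set X → ℝ} {l : ℝ} :
    IsSelfIntegral K A l ↔ Tendsto (fun p : TaggedPartition A => p.sum K) (fine A) (𝓝 l) := by
  constructor
  · intro h
    refine tendsto_of_seq_tendsto fun p hp => ?_
    exact h (RiemannSystem.ofSeq p hp)
  · intro h R
    exact h.comp R.tendsto_partition

theorem isQuasiSelfIntegral_of_tendsto {H : X × X → Set (X × X) → ℝ} {l : ℝ}
    (h : Tendsto (fun pq : TaggedPartition A × TaggedPartition B =>
      pq.1.sum fun x I => pq.2.sum fun y J => H (x, y) (I ×ˢ J)) (fine A ×ˢ fine B) (𝓝 l)) :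
    IsQuasiSelfIntegral H A B l := fun R S =>
  h.comp (R.tendsto_partition.prodMap S.tendsto_partition)

theorem IsQuasiSelfIntegral.unique [(fine A).NeBot] [(fine B).NeBot]
    {H : X × X → Set (X × X) → ℝ} {l l' : ℝ} (h : IsQuasiSelfIntegral H A B l)
    (h' : IsQuasiSelfIntegral H A B l') : l = l' :=
  let ⟨R⟩ := nonempty_riemannSystem A
  let ⟨S⟩ := nonempty_riemannSystem B
  tendsto_nhds_unique (h R S) (h' R S)

end Fine

/-- A finite cover by balls of radius δ/2 is made disjoint and intersected with A. -/
theorem exists_taggedPartition_mesh_le {X : Type*} [MeasurableSpace X] [PseudoEMetricSpace X]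
    [OpensMeasurableSpace X] {A : Set X} (hA : MeasurableSet A) (ht : TotallyBounded A)
    {δ : ℝ≥0∞} (hδ : 0 < δ) : ∃ p : TaggedPartition A, p.mesh ≤ δ := by
  classical
  obtain ⟨t, htf, hcov⟩ := EMetric.totallyBounded_iff.1 ht (δ / 2) (ENNReal.half_pos hδ.ne')
  obtain ⟨n, e, he⟩ := htf.fin_embedding
  let b : ℕ → Set X := fun k => if h : k < n then Metric.eball (e ⟨k, h⟩) (δ / 2) else ∅
  have hbm : ∀ k, MeasurableSet (b k) := fun k => by
    by_cases h : k < n <;> simp [b, h, Metric.isOpen_eball.measurableSet]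
  have hbd : ∀ k, Metric.ediam (b k) ≤ δ := fun k => by
    by_cases h : k < n
    · simp only [b, h, dif_pos]
      exact Metric.ediam_eball_le.trans (ENNReal.mul_div_cancel (by norm_num) (by norm_num)).le
    · simp [b, h]
  have hbA : A ⊆ ⋃ k, b k := fun x hx => by
    obtain ⟨y, hy, hxy⟩ := mem_iUnion₂.1 (hcov hx)
    obtain ⟨i, rfl⟩ := he.symm.subset hy
    exact mem_iUnion.2 ⟨i, by simpa [b] using hxy⟩
  let c : ℕ → Set X := fun k => A ∩ disjointed b k
  have hcU : (⋃ k, c k) = A := by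
    rw [← inter_iUnion, iUnion_disjointed, inter_eq_left]
    exact hbA
  -- Empty cells are dropped, since they cannot carry a tag.
  let ι := {k : Fin n // (c k).Nonempty}
  have hd : Pairwise (Disjoint on fun i : ι => c i.1) := fun i j hij =>
    (disjoint_disjointed b fun h => hij (Subtype.ext (Fin.ext h))).mono
      inter_subset_right inter_subset_right
  have hU : (⋃ i : ι, c i.1) = A := by
    refine (iUnion_subset fun i => inter_subset_left).antisymm fun x hx => ?_
    obtain ⟨k, hk⟩ := mem_iUnion.1 (hcU.symm.subset hx)
    have hkn : k < n := by
      by_contra h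
      have := disjointed_subset b k hk.2
      simp [b, h] at this
    exact mem_iUnion.2 ⟨⟨⟨k, hkn⟩, ⟨x, hk⟩⟩, hk⟩
  refine ⟨TaggedPartition.ofFintype (ι := ι) (fun i => c i.1) (fun i => i.2.some)
    (fun i => hA.inter (MeasurableSet.disjointed hbm _)) hd hU (fun i => i.2.some_mem), ?_⟩
  rw [TaggedPartition.mesh_ofFintype]
  exact iSup_le fun i => (Metric.ediam_mono (inter_subset_right.trans
    (disjointed_subset b i))).trans (hbd _)

theorem neBot_fine {X : Type*} [MeasurableSpace X] [PseudoEMetricSpace X]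
    [OpensMeasurableSpace X] {A : Set X} (hA : MeasurableSet A) (ht : TotallyBounded A) :
    (fine A).NeBot := by
  refine ENNReal.nhds_zero_basis_Iic.comap TaggedPartition.mesh |>.neBot_iff.2 fun {δ} hδ => ?_
  obtain ⟨p, hp⟩ := exists_taggedPartition_mesh_le hA ht hδ
  exact ⟨p, hp⟩

/-! ### Self-integrals over subsets: existence, uniform approximation, vanishing on tails. -/

theorem RealMeasureOn.apply_biUnion_finset {X : Type*} [MeasurableSpace X] [Bornology X]
    {D : Set X} (μ : RealMeasureOn D) {A : ℕ → Set X} (hA : ∀ i, MeasurableSet (A i))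
    (hd : Pairwise (Disjoint on A)) (s : Finset ℕ) (hb : IsBounded (⋃ i ∈ s, A i))
    (hD : (⋃ i ∈ s, A i) ⊆ D) : μ (⋃ i ∈ s, A i) = ∑ i ∈ s, μ (A i) := by
  classical
  have h := μ.hasSum_iUnion' (fun i => ⋃ _ : i ∈ s, A i)
    (fun i => MeasurableSet.iUnion fun _ => hA i)
    (fun i j hij => (hd hij).mono (iUnion_subset fun _ => le_rfl) (iUnion_subset fun _ => le_rfl))
    hb hD
  have h2 : HasSum (fun i => μ (⋃ _ : i ∈ s, A i)) (∑ i ∈ s, μ (⋃ _ : i ∈ s, A i)) :=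
    hasSum_sum_of_ne_finset_zero fun i hi => by simp [hi, μ.apply_empty]
  rw [h.unique h2]
  exact Finset.sum_congr rfl fun i hi => by simp [hi]

/-- The self-integral of `K` over `A`, with a junk value if it does not exist. -/
def selfIntegral {X : Type*} [MeasurableSpace X] [PseudoEMetricSpace X] (K : X → Set X → ℝ)
    (A : Set X) : ℝ :=
  limUnder (fine A) fun p => p.sum K

section

variable {X : Type*} [MeasurableSpace X] [PseudoEMetricSpace X] [OpensMeasurableSpace X]
  {K : X → Set X → ℝ} {A B D : Set X} {l : ℝ}

theorem tendsto_selfIntegral (hD : MeasurableSet D) (ht : TotallyBounded D)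
    (hl : IsSelfIntegral K D l) (hA : MeasurableSet A) (hAD : A ⊆ D) :
    Tendsto (fun p : TaggedPartition A => p.sum K) (fine A) (𝓝 (selfIntegral K A)) := by
  have := neBot_fine hA (ht.subset hAD)
  have := neBot_fine (hD.diff hA) (ht.subset sdiff_subset)
  refine tendsto_nhds_limUnder (cauchy_map_iff_exists_tendsto.1 ?_)
  have hU : A ∪ D \ A = D := union_sdiff_cancel hAD
  have h := (isSelfIntegral_iff.1 hl).comp (tendsto_union disjoint_sdiff_right hU)
  simp only [Function.comp_def, TaggedPartition.sum_union] at h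
  refine Metric.cauchy_iff.2 ⟨inferInstance, fun ε hε => ?_⟩
  -- One fixed partition q of D \ A completes all sufficiently fine partitions p, p' of A. The
  -- contribution of q cancels in the difference of the two sums over D, which proves the Cauchy
  -- property.
  obtain ⟨q, hq⟩ := ((eventually_swap_iff.1 (Metric.tendsto_nhds.1 h (ε / 2) (half_pos hε))).curry
    ).exists
  refine ⟨_, image_mem_map hq, ?_⟩
  rintro _ ⟨p, hp, rfl⟩ _ ⟨p', hp', rfl⟩
  have h3 := dist_triangle_right _ _ _ |>.trans_lt (add_lt_add hp hp')
  simpa using h3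

theorem isSelfIntegral_selfIntegral (hD : MeasurableSet D) (ht : TotallyBounded D)
    (hl : IsSelfIntegral K D l) (hA : MeasurableSet A) (hAD : A ⊆ D) :
    IsSelfIntegral K A (selfIntegral K A) :=
  isSelfIntegral_iff.2 (tendsto_selfIntegral hD ht hl hA hAD)

theorem selfIntegrable_of_subset (hD : MeasurableSet D) (ht : TotallyBounded D)
    (hl : IsSelfIntegral K D l) (hA : MeasurableSet A) (hAD : A ⊆ D) : SelfIntegrable K A := by
  have := neBot_fine hA (ht.subset hAD)
  exact ⟨_, isSelfIntegral_selfIntegral hD ht hl hA hAD, fun l' hl' =>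
    tendsto_nhds_unique (isSelfIntegral_iff.1 hl') (tendsto_selfIntegral hD ht hl hA hAD)⟩

theorem selfIntegral_union (hD : MeasurableSet D) (ht : TotallyBounded D)
    (hl : IsSelfIntegral K D l) (hA : MeasurableSet A) (hAD : A ⊆ D) (hB : MeasurableSet B)
    (hBD : B ⊆ D) (hAB : Disjoint A B) :
    selfIntegral K (A ∪ B) = selfIntegral K A + selfIntegral K B := by
  have := neBot_fine hA (ht.subset hAD)
  have := neBot_fine hB (ht.subset hBD)
  have h := (tendsto_selfIntegral hD ht hl (hA.union hB) (union_subset hAD hBD)).comp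
    (tendsto_union hAB rfl)
  simp only [Function.comp_def, TaggedPartition.sum_union] at h
  exact tendsto_nhds_unique h
    (((tendsto_selfIntegral hD ht hl hA hAD).comp tendsto_fst).add
      ((tendsto_selfIntegral hD ht hl hB hBD).comp tendsto_snd))

theorem selfIntegral_diff (hD : MeasurableSet D) (ht : TotallyBounded D)
    (hl : IsSelfIntegral K D l) (hA : MeasurableSet A) (hAD : A ⊆ D) (hB : MeasurableSet B)
    (hBA : B ⊆ A) : selfIntegral K (A \ B) = selfIntegral K A - selfIntegral K B := by
  rw [eq_sub_iff_add_eq, ← selfIntegral_union hD ht hl (hA.diff hB) (sdiff_subset.trans hAD) hB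
    (hBA.trans hAD) disjoint_sdiff_left, sdiff_union_of_subset hBA]

/-- The Riemann sums approximate the self-integrals uniformly over the measurable subsets. -/
theorem exists_mesh_forall_dist_selfIntegral_le (hD : MeasurableSet D) (ht : TotallyBounded D)
    (hl : IsSelfIntegral K D l) {ε : ℝ} (hε : 0 < ε) :
    ∃ δ > 0, ∀ A, MeasurableSet A → A ⊆ D → ∀ p : TaggedPartition A, p.mesh ≤ δ →
      dist (p.sum K) (selfIntegral K A) ≤ ε := by
  obtain ⟨δ, hδ, h⟩ := eventually_fine_iff.1
    (Metric.tendsto_nhds.1 (tendsto_selfIntegral hD ht hl hD Subset.rfl) ε hε)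
  refine ⟨δ, hδ, fun A hA hAD p hp => ?_⟩
  have := neBot_fine (hD.diff hA) (ht.subset sdiff_subset)
  have hU : A ∪ D \ A = D := union_sdiff_cancel hAD
  -- Here p stays fixed and only the partition q of the complement is refined. The bound for the
  -- sums over D survives the limit, and δ depends on D alone.
  have hlim : Tendsto (fun q : TaggedPartition (D \ A) => dist (p.sum K + q.sum K)
      (selfIntegral K D)) (fine (D \ A))
      (𝓝 (dist (p.sum K + selfIntegral K (D \ A)) (selfIntegral K D))) :=
    ((tendsto_selfIntegral hD ht hl (hD.diff hA) sdiff_subset).const_add _).dist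
      tendsto_const_nhds
  have hle : dist (p.sum K + selfIntegral K (D \ A)) (selfIntegral K D) ≤ ε := by
    refine le_of_tendsto hlim ?_
    filter_upwards [eventually_mesh_le hδ] with q hq
    have := h (p.union q disjoint_sdiff_right hU)
      (by rw [TaggedPartition.mesh_union]; exact sup_le hp hq)
    rw [TaggedPartition.sum_union] at this
    exact this.le
  rw [selfIntegral_diff hD ht hl hD Subset.rfl hA hAD, Real.dist_eq] at hle
  rw [Real.dist_eq]
  convert hle using 2
  ring

end

/-- A fixed fine partition of the union has finitely many tags, so the tails eventually contain none
of them and can be cut out of all its cells. The Riemann sum then changes little, by σ-additivity of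
each `K x`. Uniform approximation before and after the cut shows that the self-integral over the
tail is small: three errors of ε/4. -/
theorem tendsto_selfIntegral_diff_biUnion {X : Type*} [MeasurableSpace X] [PseudoMetricSpace X]
    [OpensMeasurableSpace X] {D : Set X} {l : ℝ} (K : X → RealMeasureOn (univ : Set X))
    (hD : MeasurableSet D) (ht : TotallyBounded D)
    (hl : IsSelfIntegral (fun x => K x) D l) {A : ℕ → Set X}
    (hA : ∀ i, MeasurableSet (A i)) (hd : Pairwise (Disjoint on A)) (hAD : (⋃ i, A i) ⊆ D) :
    Tendsto (fun s : Finset ℕ => selfIntegral (fun x => K x) ((⋃ i, A i) \ ⋃ i ∈ s, A i)) atTop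
      (𝓝 0) := by
  set U := ⋃ i, A i with hUdef
  have hU : MeasurableSet U := MeasurableSet.iUnion hA
  have hUb : IsBounded U := (ht.subset hAD).isBounded
  have hsU : ∀ s : Finset ℕ, (⋃ i ∈ s, A i) ⊆ U := fun s =>
    iUnion₂_subset fun i _ => subset_iUnion A i
  have hsm : ∀ s : Finset ℕ, MeasurableSet (⋃ i ∈ s, A i) := fun s =>
    s.measurableSet_biUnion fun i _ => hA i
  refine Metric.tendsto_nhds.2 fun ε hε => ?_
  obtain ⟨δ, hδ, h⟩ := exists_mesh_forall_dist_selfIntegral_le hD ht hl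
    (show (0 : ℝ) < ε / 4 by positivity)
  obtain ⟨p, hp⟩ := exists_taggedPartition_mesh_le hU (ht.subset hAD) hδ
  have htag : ∀ᶠ s : Finset ℕ in atTop, ∀ j, p.tag j ∉ U \ ⋃ i ∈ s, A i := by
    refine eventually_all.2 fun j => ?_
    obtain ⟨i, hi⟩ := mem_iUnion.1 (p.tag_mem_set j)
    filter_upwards [eventually_ge_atTop {i}] with s hs hj
    exact hj.2 (mem_iUnion₂.2 ⟨i, hs (Finset.mem_singleton_self i), hi⟩)
  have hsum : Tendsto (fun s : Finset ℕ => ∑ j, K (p.tag j) (p.cell j \ (U \ ⋃ i ∈ s, A i)))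
      atTop (𝓝 (p.sum fun x => K x)) := by
    refine tendsto_finsetSum _ fun j _ => ?_
    have hU' : (⋃ i, p.cell j ∩ A i) = p.cell j := by
      rw [← inter_iUnion]
      exact inter_eq_left.2 (p.cell_subset j)
    have hm : ∀ i, MeasurableSet (p.cell j ∩ A i) := fun i =>
      (p.measurableSet_cell j).inter (hA i)
    have hd' : Pairwise (Disjoint on fun i => p.cell j ∩ A i) := fun a b hab =>
      (hd hab).mono inter_subset_right inter_subset_right
    have hs := (K (p.tag j)).hasSum_iUnion' (fun i => p.cell j ∩ A i) hm hd'
      (by rw [hU']; exact hUb.subset (p.cell_subset j)) (subset_univ _)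
    rw [hU'] at hs
    refine Tendsto.congr (fun s => ?_) hs
    rw [← (K (p.tag j)).apply_biUnion_finset hm hd' s
      (hUb.subset (iUnion₂_subset fun i _ => inter_subset_left.trans (p.cell_subset j)))
      (subset_univ _)]
    congr 1
    rw [← inter_iUnion₂]
    ext x
    have := fun hx => p.cell_subset j (a := x) hx
    simp only [mem_inter_iff, Set.mem_sdiff]
    tauto
  filter_upwards [htag, Metric.tendsto_nhds.1 hsum (ε / 4) (by positivity)] with s hs1 hs2
  have e1 := h U hU hAD p hp
  have e2 := h _ (hU.diff (hU.diff (hsm s))) (sdiff_subset.trans hAD)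
    (p.diff (hU.diff (hsm s)) hs1) ((p.mesh_diff_le _ _).trans hp)
  have e3 : dist ((p.diff (hU.diff (hsm s)) hs1).sum fun x => K x) (p.sum fun x => K x) < ε / 4 :=
    hs2
  rw [selfIntegral_diff hD ht hl hU hAD (hU.diff (hsm s)) sdiff_subset] at e2
  rw [Real.dist_eq, abs_le] at e1 e2
  rw [Real.dist_eq, abs_lt] at e3 ⊢
  constructor <;> linarith [e1.1, e1.2, e2.1, e2.2, e3.1, e3.2]

/-! ### Square integrable densities from the covariance measure of a Hilbert-valued measure. -/

theorem isFiniteMeasure_variation {X : Type*} [MeasurableSpace X] (μ : SignedMeasure X) :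
    IsFiniteMeasure μ.variation := by
  rw [← SignedMeasure.totalVariation_eq_variation]
  infer_instance

section VectorMeasure

variable {X : Type*} [MeasurableSpace X] {H : Type*} [NormedAddCommGroup H]
  [InnerProductSpace ℝ H]

/-- Inclusion of the simple functions in `L²`, for a finite measure. -/
def simpleFuncToLp (ν : Measure X) [IsFiniteMeasure ν] : SimpleFunc X ℝ →ₗ[ℝ] Lp ℝ 2 ν where
  toFun f := (f.memLp_of_isFiniteMeasure 2 ν).toLp f
  map_add' _ _ := rfl
  map_smul' _ _ := rfl

theorem denseRange_simpleFuncToLp (ν : Measure X) [IsFiniteMeasure ν] :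
    DenseRange (simpleFuncToLp ν) := by
  refine (Lp.simpleFunc.dense (E := ℝ) (μ := ν) (p := 2) (by norm_num)).mono fun f hf => ?_
  refine ⟨Lp.simpleFunc.toSimpleFunc ⟨f, hf⟩, ?_⟩
  exact congrArg Subtype.val (Lp.simpleFunc.toLp_toSimpleFunc ⟨f, hf⟩)

theorem norm_simpleFuncToLp_sq (ν : Measure X) [IsFiniteMeasure ν] (f : SimpleFunc X ℝ) :
    ‖simpleFuncToLp ν f‖ ^ 2 = ∑ c ∈ f.range, ν.real (f ⁻¹' {c}) * c ^ 2 := by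
  rw [← real_inner_self_eq_norm_sq, L2.inner_def]
  have h : ∫ x, f x ^ 2 ∂ν = ∑ c ∈ f.range, ν.real (f ⁻¹' {c}) * c ^ 2 := by
    have hi : Integrable f ν := f.integrable_of_isFiniteMeasure
    have h1 := SimpleFunc.map_integral (μ := ν) f (fun c : ℝ => c ^ 2) hi (by simp)
    rw [SimpleFunc.integral_eq_integral _ (SimpleFunc.integrable_of_isFiniteMeasure _)] at h1
    simpa using h1
  rw [← h]
  refine integral_congr_ae ?_
  filter_upwards [(f.memLp_of_isFiniteMeasure 2 ν).coeFn_toLp] with x hx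
  change inner ℝ (((f.memLp_of_isFiniteMeasure 2 ν).toLp f : Lp ℝ 2 ν) x)
    (((f.memLp_of_isFiniteMeasure 2 ν).toLp f : Lp ℝ 2 ν) x) = _
  simp [hx, sq]

variable (m : Set X → H) (γ : SignedMeasure (X × X))

/-- The sum of the two marginals of the variation of a signed measure on `X × X`. -/
def marginalSum : Measure X := γ.variation.map Prod.fst + γ.variation.map Prod.snd

instance : IsFiniteMeasure (marginalSum γ) := by
  have := isFiniteMeasure_variation γ
  unfold marginalSum
  infer_instance

/-- A Schur test: expand the square, use |cᵢcⱼ| ≤ (cᵢ² + cⱼ²)/2 and |γ| ≤ `γ.variation`, then sum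
over the free index to reach a marginal. It says that integrating simple functions against m is a
contraction from L² of `marginalSum γ` to H. -/
theorem norm_sum_smul_sq_le
    (hγ : ∀ A B, MeasurableSet A → MeasurableSet B → γ (A ×ˢ B) = inner ℝ (m A) (m B))
    {ι : Type*} (s : Finset ι) (c : ι → ℝ) (A : ι → Set X) (hA : ∀ i, MeasurableSet (A i))
    (hd : Pairwise (Disjoint on A)) :
    ‖∑ i ∈ s, c i • m (A i)‖ ^ 2 ≤ ∑ i ∈ s, (marginalSum γ).real (A i) * c i ^ 2 := by
  have := isFiniteMeasure_variation γ
  have hle : ∀ i j, c i * c j * γ (A i ×ˢ A j) ≤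
      c i ^ 2 / 2 * γ.variation.real (A i ×ˢ A j) + c j ^ 2 / 2 * γ.variation.real (A i ×ˢ A j) :=
    fun i j => by
    have h1 : |γ (A i ×ˢ A j)| ≤ γ.variation.real (A i ×ˢ A j) := by
      rw [← Real.norm_eq_abs]
      exact VectorMeasure.norm_measure_le_variation (measure_ne_top _ _)
    calc c i * c j * γ (A i ×ˢ A j) ≤ |c i * c j| * |γ (A i ×ˢ A j)| := by
          rw [← abs_mul]; exact le_abs_self _
      _ ≤ (c i ^ 2 / 2 + c j ^ 2 / 2) * γ.variation.real (A i ×ˢ A j) := by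
          refine mul_le_mul ?_ h1 (abs_nonneg _) (by positivity)
          rw [abs_mul]
          nlinarith [sq_nonneg (|c i| - |c j|), sq_abs (c i), sq_abs (c j)]
      _ = _ := add_mul _ _ _
  have hfst : ∀ i, ∑ j ∈ s, γ.variation.real (A i ×ˢ A j) ≤ (marginalSum γ).real (A i) :=
    fun i => by
    rw [← measureReal_biUnion_finset (fun a _ b _ hab => by
        exact disjoint_left.2 fun x hx hy => (disjoint_left.1 (hd hab)) hx.2 hy.2)
      (fun j _ => (hA i).prod (hA j))]
    rw [marginalSum, measureReal_add_apply, map_measureReal_apply measurable_fst (hA i)]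
    refine le_add_of_le_of_nonneg (measureReal_mono ?_) measureReal_nonneg
    exact iUnion₂_subset fun j _ x hx => hx.1
  have hsnd : ∀ j, ∑ i ∈ s, γ.variation.real (A i ×ˢ A j) ≤ (marginalSum γ).real (A j) :=
    fun j => by
    rw [← measureReal_biUnion_finset (fun a _ b _ hab => by
        exact disjoint_left.2 fun x hx hy => (disjoint_left.1 (hd hab)) hx.1 hy.1)
      (fun i _ => (hA i).prod (hA j))]
    rw [marginalSum, measureReal_add_apply, map_measureReal_apply measurable_snd (hA j)]
    refine le_add_of_nonneg_of_le measureReal_nonneg (measureReal_mono ?_)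
    exact iUnion₂_subset fun j _ x hx => hx.2
  calc ‖∑ i ∈ s, c i • m (A i)‖ ^ 2 = ∑ i ∈ s, ∑ j ∈ s, c i * c j * γ (A i ×ˢ A j) := by
        rw [← real_inner_self_eq_norm_sq, sum_inner]
        refine Finset.sum_congr rfl fun i _ => ?_
        rw [inner_sum]
        refine Finset.sum_congr rfl fun j _ => ?_
        rw [hγ _ _ (hA i) (hA j), real_inner_smul_left, real_inner_smul_right]
        ring
    _ ≤ ∑ i ∈ s, ∑ j ∈ s, (c i ^ 2 / 2 * γ.variation.real (A i ×ˢ A j)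
          + c j ^ 2 / 2 * γ.variation.real (A i ×ˢ A j)) :=
        Finset.sum_le_sum fun i _ => Finset.sum_le_sum fun j _ => hle i j
    _ = ∑ i ∈ s, c i ^ 2 / 2 * ∑ j ∈ s, γ.variation.real (A i ×ˢ A j)
          + ∑ j ∈ s, c j ^ 2 / 2 * ∑ i ∈ s, γ.variation.real (A i ×ˢ A j) := by
        simp only [Finset.sum_add_distrib, Finset.mul_sum]
        congr 1
        exact Finset.sum_comm
    _ ≤ ∑ i ∈ s, c i ^ 2 / 2 * (marginalSum γ).real (A i)
          + ∑ j ∈ s, c j ^ 2 / 2 * (marginalSum γ).real (A j) :=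
        add_le_add
          (Finset.sum_le_sum fun i _ => mul_le_mul_of_nonneg_left (hfst i) (by positivity))
          (Finset.sum_le_sum fun i _ => mul_le_mul_of_nonneg_left (hsnd i) (by positivity))
    _ = _ := by
        rw [← Finset.sum_add_distrib]
        exact Finset.sum_congr rfl fun i _ => by ring

/-- An orthogonally dominated vector measure `m` is represented by square integrable densities
with respect to the marginals of its covariance measure. -/
theorem exists_density_of_inner_eq [CompleteSpace H]
    (hm : ∀ A B, MeasurableSet A → MeasurableSet B → Disjoint A B → m (A ∪ B) = m A + m B)
    (hγ : ∀ A B, MeasurableSet A → MeasurableSet B → γ (A ×ˢ B) = inner ℝ (m A) (m B)) :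
    ∃ r : H →L[ℝ] Lp ℝ 2 (marginalSum γ), ∀ h A, MeasurableSet A →
      ∫ x in A, r h x ∂(marginalSum γ) = inner ℝ h (m A) := by
  set ν := marginalSum γ
  let T : Set X → ℝ →L[ℝ] H := fun A => ContinuousLinearMap.toSpanSingleton ℝ (m A)
  have hT : FinMeasAdditive ν T := fun A B hA hB _ _ hAB => by
    ext
    simp [T, hm A B hA hB hAB]
  have hT0 : T ∅ = 0 := by
    have := hm ∅ ∅ .empty .empty disjoint_bot_left
    ext
    simpa [T] using this
  let S : SimpleFunc X ℝ →ₗ[ℝ] H :=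
    { toFun := fun f => f.setToSimpleFunc T
      map_add' := fun f g => SimpleFunc.setToSimpleFunc_add T hT
        f.integrable_of_isFiniteMeasure g.integrable_of_isFiniteMeasure
      map_smul' := fun c f => SimpleFunc.setToSimpleFunc_smul_real T hT c
        f.integrable_of_isFiniteMeasure }
  have hS : ∀ f, ‖S f‖ ≤ 1 * ‖simpleFuncToLp ν f‖ := fun f => by
    rw [one_mul]
    refine le_of_sq_le_sq ?_ (norm_nonneg _)
    rw [norm_simpleFuncToLp_sq]
    refine le_trans (le_of_eq ?_) (norm_sum_smul_sq_le m γ hγ f.range (fun c => c)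
      (fun c => f ⁻¹' {c}) (fun c => f.measurableSet_fiber c)
      (fun a b hab => (disjoint_singleton.2 hab).preimage f))
    rfl
  let L := S.extendOfNorm (simpleFuncToLp ν)
  have hL : ∀ f, L (simpleFuncToLp ν f) = S f :=
    S.extendOfNorm_eq (denseRange_simpleFuncToLp ν) ⟨1, hS⟩
  -- `L` extends integration against m to all of L²(ν). Its adjoint produces densities because ⟨L*
  -- h, 1_A⟩ = ⟨h, L 1_A⟩ = ⟨h, m A⟩.
  refine ⟨ContinuousLinearMap.adjoint L, fun h A hA => ?_⟩
  let f : SimpleFunc X ℝ := SimpleFunc.piecewise A hA (SimpleFunc.const X 1) (SimpleFunc.const X 0)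
  have hf : simpleFuncToLp ν f = indicatorConstLp 2 hA (measure_ne_top ν A) 1 := by
    refine Lp.ext ?_
    filter_upwards [(f.memLp_of_isFiniteMeasure 2 ν).coeFn_toLp,
      indicatorConstLp_coeFn (p := 2) (hs := hA) (hμs := measure_ne_top ν A) (c := (1 : ℝ))]
      with x h1 h2
    rw [h2]
    refine h1.trans ?_
    simp [f, indicator, Set.piecewise]
  have hSf : S f = m A := by
    refine (SimpleFunc.setToSimpleFunc_indicator T hT0 hA (1 : ℝ)).trans ?_
    simp [T]
  rw [← hSf, ← hL, hf, ← ContinuousLinearMap.adjoint_inner_left]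
  rw [real_inner_comm, L2.inner_indicatorConstLp_one]

end VectorMeasure

/-! ### Double sums of the second-order kernel as inner products in L²(ν⊗ν). -/

section Tensor

theorem eLpNorm_two_prod_le {X Y : Type*} [MeasurableSpace X] [MeasurableSpace Y]
    {μ : Measure X} {ν : Measure Y} [SFinite μ] [SFinite ν] {F : X × Y → ℝ}
    (hF : AEStronglyMeasurable F (μ.prod ν)) {c : ℝ≥0∞}
    (h : ∀ x, eLpNorm (fun y => F (x, y)) 2 ν ≤ c) :
    eLpNorm F 2 (μ.prod ν) ^ (2 : ℝ) ≤ c ^ (2 : ℝ) * μ univ := by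
  have e := eLpNorm_nnreal_pow_eq_lintegral (f := F) (μ := μ.prod ν) (p := 2) (by norm_num)
  have e' := fun x => eLpNorm_nnreal_pow_eq_lintegral (f := fun y => F (x, y)) (μ := ν) (p := 2)
    (by norm_num)
  simp only [NNReal.coe_ofNat, ENNReal.coe_ofNat] at e e'
  rw [e, lintegral_prod _ (hF.enorm.pow_const _), ← lintegral_const]
  refine lintegral_mono fun x => ?_
  rw [← e' x]
  exact ENNReal.rpow_le_rpow (h x) (by norm_num)

variable {X : Type*} [MeasurableSpace X] {ν : Measure X} [IsFiniteMeasure ν] {A B D : Set X}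

/-- The kernel `(u, v) ↦ g (x u) v`, where `x u` is the tag of the cell that contains `u`. -/
def tensorSum (g : X → Lp ℝ 2 ν) (p : TaggedPartition A) (w : X × X) : ℝ :=
  ∑ j, (Prod.fst ⁻¹' p.cell j).indicator (fun w : X × X => g (p.tag j) w.2) w

omit [IsFiniteMeasure ν] in
theorem tensorSum_of_mem (g : X → Lp ℝ 2 ν) (p : TaggedPartition A) {j : Fin p.card} {u : X}
    (hu : u ∈ p.cell j) (v : X) : tensorSum g p (u, v) = g (p.tag j) v := by
  rw [tensorSum, Finset.sum_eq_single j]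
  · simp [hu]
  · intro i _ hij
    have : u ∉ p.cell i := disjoint_right.1 (p.disjoint_cell hij) hu
    simp [this]
  · simp

omit [IsFiniteMeasure ν] in
theorem tensorSum_of_notMem (g : X → Lp ℝ 2 ν) (p : TaggedPartition A) {u : X}
    (hu : u ∉ A) (v : X) : tensorSum g p (u, v) = 0 :=
  Finset.sum_eq_zero fun j _ =>
    indicator_of_notMem (s := Prod.fst ⁻¹' p.cell j) (fun h => hu (p.cell_subset j h)) _

theorem memLp_tensorSum_summand (f : Lp ℝ 2 ν) {I : Set X} (hI : MeasurableSet I) :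
    MemLp ((Prod.fst ⁻¹' I).indicator fun w : X × X => f w.2) 2 (ν.prod ν) :=
  ((Lp.memLp f).comp_snd ν).indicator (measurable_fst hI)

theorem memLp_tensorSum (g : X → Lp ℝ 2 ν) (p : TaggedPartition A) :
    MemLp (tensorSum g p) 2 (ν.prod ν) :=
  memLp_finsetSum _ fun j _ => memLp_tensorSum_summand (g (p.tag j)) (p.measurableSet_cell j)

/-- On a rectangle I × J with tags x, y the integrand is g_x(v) g_y(u), which Fubini splits. The
double sum, whose tags and cells are crossed, becomes an inner product in which each factor involves
one partition only. -/
theorem integral_tensorSum_mul_swap (g : X → Lp ℝ 2 ν) (p : TaggedPartition A)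
    (q : TaggedPartition B) :
    ∫ w, tensorSum g p w * tensorSum g q w.swap ∂(ν.prod ν) =
      p.sum fun x I => q.sum fun y J => (∫ u in I, g y u ∂ν) * ∫ v in J, g x v ∂ν := by
  have hsw : MeasurePreserving Prod.swap (ν.prod ν) (ν.prod ν) := Measure.measurePreserving_swap
  simp only [tensorSum, Finset.sum_mul_sum]
  have hI : ∀ j k, Integrable (fun w : X × X =>
      (Prod.fst ⁻¹' p.cell j).indicator (fun w : X × X => g (p.tag j) w.2) w *
      (Prod.fst ⁻¹' q.cell k).indicator (fun w : X × X => g (q.tag k) w.2) w.swap) (ν.prod ν) :=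
    fun j k => (memLp_tensorSum_summand (g (p.tag j)) (p.measurableSet_cell j)).integrable_mul
      ((memLp_tensorSum_summand (g (q.tag k)) (q.measurableSet_cell k)).comp_measurePreserving hsw)
  rw [integral_finsetSum _ fun j _ => integrable_finsetSum _ fun k _ => hI j k]
  refine Finset.sum_congr rfl fun j _ => ?_
  rw [integral_finsetSum _ fun k _ => hI j k]
  refine Finset.sum_congr rfl fun k _ => ?_
  change _ = (∫ u in p.cell j, g (q.tag k) u ∂ν) * ∫ v in q.cell k, g (p.tag j) v ∂ν
  rw [← integral_indicator (p.measurableSet_cell j), ← integral_indicator (q.measurableSet_cell k),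
    ← integral_prod_mul]
  congr 1 with w
  by_cases h1 : w.1 ∈ p.cell j <;> by_cases h2 : w.2 ∈ q.cell k <;> simp [h1, h2, mul_comm]

end Tensor

section Limit

variable {X : Type*} [MeasurableSpace X] [PseudoEMetricSpace X] {ν : Measure X} [IsFiniteMeasure ν]
  {A B D : Set X} {g : X → Lp ℝ 2 ν}

/-- On the slice at u ∈ A the difference is that of g at two tags, both close to u. Uniform
continuity bounds every slice by η, hence the squared norm by η² ν(X). -/
theorem exists_mesh_forall_eLpNorm_tensorSum_sub_le (hg : UniformContinuousOn g D) {ε : ℝ≥0∞}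
    (hε : 0 < ε) : ∃ δ > 0, ∀ A, A ⊆ D → MeasurableSet A → ∀ (p : TaggedPartition A)
      (q : TaggedPartition D), p.mesh ≤ δ → q.mesh ≤ δ →
      eLpNorm (tensorSum g p - (Prod.fst ⁻¹' A).indicator (tensorSum g q)) 2 (ν.prod ν) ≤ ε := by
  obtain ⟨η, hη, hηε⟩ : ∃ η : ℝ≥0∞, 0 < η ∧ η ^ (2 : ℝ) * ν univ ≤ ε ^ (2 : ℝ) := by
    have hlim : Tendsto (fun η : ℝ≥0∞ => η ^ (2 : ℝ) * ν univ) (𝓝 0) (𝓝 0) := by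
      have h := ENNReal.Tendsto.mul_const (b := ν univ)
        ((ENNReal.continuous_rpow_const (y := 2)).tendsto 0) (Or.inr (measure_ne_top ν univ))
      simpa using h
    have hpos : (0 : ℝ≥0∞) < ε ^ (2 : ℝ) := ENNReal.rpow_pos_of_nonneg hε (by norm_num)
    obtain ⟨η, hη, h⟩ := ENNReal.nhds_zero_basis_Iic.eventually_iff.1
      (hlim.eventually (ge_mem_nhds hpos))
    exact ⟨η, hη, h self_mem_Iic⟩
  obtain ⟨δ, hδ, h⟩ := EMetric.uniformContinuousOn_iff.1 hg η hη
  obtain ⟨δ', hδ', hδδ⟩ : ∃ δ' : ℝ≥0∞, 0 < δ' ∧ δ' + δ' < δ := by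
    obtain ⟨t, ht0, ht⟩ := exists_between hδ
    exact ⟨t / 2, ENNReal.half_pos ht0.ne', by rwa [ENNReal.add_halves]⟩
  refine ⟨δ', hδ', fun A hAD hA p q hp hq => ?_⟩
  rw [← ENNReal.rpow_le_rpow_iff (z := 2) (by norm_num)]
  refine (eLpNorm_two_prod_le ((memLp_tensorSum g p).sub
    ((memLp_tensorSum g q).indicator (measurable_fst hA))).1 (c := η) fun u => ?_).trans hηε
  by_cases hu : u ∈ A
  · obtain ⟨j, hj⟩ := mem_iUnion.1 (p.iUnion_cell.symm.subset hu)
    obtain ⟨k, hk⟩ := mem_iUnion.1 (q.iUnion_cell.symm.subset (hAD hu))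
    have e : (fun v => (tensorSum g p - (Prod.fst ⁻¹' A).indicator (tensorSum g q)) (u, v))
        = ⇑(g (p.tag j)) - ⇑(g (q.tag k)) := funext fun v => by
      simp [hu, tensorSum_of_mem g p hj, tensorSum_of_mem g q hk]
    rw [e, ← Lp.edist_def]
    refine (h (hAD (p.tag_mem_set j)) (q.tag_mem_set k) (lt_of_le_of_lt ?_ hδδ)).le
    exact (edist_triangle_right _ _ u).trans (add_le_add
      ((p.edist_tag_le hj).trans hp) ((q.edist_tag_le hk).trans hq))
  · have e : (fun v => (tensorSum g p - (Prod.fst ⁻¹' A).indicator (tensorSum g q)) (u, v)) = 0 :=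
      funext fun v => by simp [hu, tensorSum_of_notMem g p hu]
    rw [e]
    simp

/-- The double Riemann sums of `(u, v) ↦ g v (du) g u (dv)` over `A × B` converge to the values of
a measure with an integrable density. -/
theorem exists_integrable_tendsto_tensorSum [OpensMeasurableSpace X]
    (hg : UniformContinuousOn g D) (hD : MeasurableSet D)
    (ht : TotallyBounded D) : ∃ k : X × X → ℝ, Integrable k (ν.prod ν) ∧
      ∀ A B, MeasurableSet A → A ⊆ D → MeasurableSet B → B ⊆ D →
      Tendsto (fun pq : TaggedPartition A × TaggedPartition B =>
        pq.1.sum fun x I => pq.2.sum fun y J => (∫ u in I, g y u ∂ν) * ∫ v in J, g x v ∂ν)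
        (fine A ×ˢ fine B) (𝓝 (∫ w in A ×ˢ B, k w ∂(ν.prod ν))) := by
  have := neBot_fine hD ht
  have hsw : MeasurePreserving Prod.swap (ν.prod ν) (ν.prod ν) := Measure.measurePreserving_swap
  let κ : ∀ {A : Set X}, TaggedPartition A → Lp ℝ 2 (ν.prod ν) := fun p =>
    (memLp_tensorSum g p).toLp _
  have hcauchy : Cauchy (map (κ (A := D)) (fine D)) := by
    refine EMetric.cauchy_iff.2 ⟨NeBot.ne inferInstance, fun ε hε => ?_⟩
    obtain ⟨t, ht0, htε⟩ := exists_between hε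
    obtain ⟨δ, hδ, h⟩ := exists_mesh_forall_eLpNorm_tensorSum_sub_le hg ht0
    refine ⟨_, image_mem_map (eventually_mesh_le hδ), ?_⟩
    rintro _ ⟨p, hp, rfl⟩ _ ⟨q, hq, rfl⟩
    rw [Lp.edist_toLp_toLp]
    refine lt_of_le_of_lt ?_ htε
    refine le_of_eq_of_le ?_ (h D Subset.rfl hD p q hp hq)
    congr 2
    ext ⟨u, v⟩
    by_cases hu : u ∈ D
    · simp [hu]
    · simp [hu, tensorSum_of_notMem g q hu]
  obtain ⟨kD, hkD⟩ := cauchy_map_iff_exists_tendsto.1 hcauchy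
  have hmem : ∀ {A}, MeasurableSet A → MemLp ((Prod.fst ⁻¹' A).indicator kD) 2 (ν.prod ν) :=
    fun hA => (Lp.memLp kD).indicator (measurable_fst hA)
  -- The limit for A is the restriction of `kD` to the first coordinates in A, so a single kernel
  -- serves all subsets.
  have hlim : ∀ {A} (hA : MeasurableSet A), A ⊆ D →
      Tendsto (κ (A := A)) (fine A) (𝓝 ((hmem hA).toLp _)) := fun {A} hA hAD => by
    refine EMetric.tendsto_nhds.2 fun ε hε => ?_
    obtain ⟨t, ht0, htε⟩ := exists_between (ENNReal.half_pos hε.ne')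
    obtain ⟨δ, hδ, h⟩ := exists_mesh_forall_eLpNorm_tensorSum_sub_le hg ht0
    obtain ⟨q, hq1, hq2⟩ := ((eventually_mesh_le hδ).and
      (EMetric.tendsto_nhds.1 hkD (ε / 2) (ENNReal.half_pos hε.ne'))).exists
    filter_upwards [eventually_mesh_le hδ] with p hp
    rw [Lp.edist_toLp_toLp]
    have e : tensorSum g p - (Prod.fst ⁻¹' A).indicator kD =
        (tensorSum g p - (Prod.fst ⁻¹' A).indicator (tensorSum g q))
        + (Prod.fst ⁻¹' A).indicator (tensorSum g q - ⇑kD) := by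
      rw [indicator_sub']
      abel
    rw [e]
    refine (eLpNorm_add_le ((memLp_tensorSum g p).sub
      ((memLp_tensorSum g q).indicator (measurable_fst hA))).1
      (((memLp_tensorSum g q).sub (Lp.memLp kD)).indicator (measurable_fst hA)).1
      (by norm_num)).trans_lt ?_
    rw [← ENNReal.add_halves ε]
    refine ENNReal.add_lt_add ((h A hAD hA p q hp hq1).trans_lt htε)
      ((eLpNorm_indicator_le _).trans_lt ?_)
    rw [Lp.edist_def] at hq2
    refine lt_of_eq_of_lt (eLpNorm_congr_ae ?_) hq2
    filter_upwards [(memLp_tensorSum g q).coeFn_toLp] with w hw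
    simp [κ, hw]
  refine ⟨fun w => kD w * kD w.swap,
    (Lp.memLp kD).integrable_mul ((Lp.memLp kD).comp_measurePreserving hsw),
    fun A B hA hAD hB hBD => ?_⟩
  -- Swapping coordinates is an isometry of L²(ν⊗ν), so the double sums converge by joint continuity
  -- of the inner product.
  let σ := Lp.compMeasurePreservingₗᵢ ℝ (E := ℝ) (p := 2) Prod.swap hsw
  have h := ((σ.continuous.tendsto _).comp ((hlim hB hBD).comp tendsto_snd)).inner
    (𝕜 := ℝ) ((hlim hA hAD).comp tendsto_fst)
  have hσ : ∀ (f f' : X × X → ℝ) (hf : MemLp f 2 (ν.prod ν)) (hf' : MemLp f' 2 (ν.prod ν)),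
      inner ℝ (σ (hf'.toLp f')) (hf.toLp f) = ∫ w, f w * f' w.swap ∂(ν.prod ν) := by
    intro f f' hf hf'
    rw [L2.inner_def]
    refine integral_congr_ae ?_
    have h1 : (σ (hf'.toLp f') : X × X → ℝ) =ᵐ[ν.prod ν] (hf'.toLp f') ∘ Prod.swap :=
      Lp.coeFn_compMeasurePreserving _ hsw
    filter_upwards [h1, hf.coeFn_toLp, hsw.quasiMeasurePreserving.ae_eq_comp hf'.coeFn_toLp]
      with w h1 h2 h3
    rw [h1, h2, h3]
    simp
  rw [hσ] at h
  have e : ∫ w, (Prod.fst ⁻¹' A).indicator kD w * (Prod.fst ⁻¹' B).indicator kD w.swap ∂(ν.prod ν)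
      = ∫ w in A ×ˢ B, kD w * kD w.swap ∂(ν.prod ν) := by
    rw [← integral_indicator (hA.prod hB)]
    congr 1 with w
    by_cases h1 : w.1 ∈ A <;> by_cases h2 : w.2 ∈ B <;> simp [h1, h2]
  rw [e] at h
  refine h.congr fun pq => ?_
  rw [← integral_tensorSum_mul_swap]
  exact hσ _ _ (memLp_tensorSum g pq.1) (memLp_tensorSum g pq.2)

end Limit

/-! ### Sums against signed measures, Loève's criterion, measures of tails. -/

/-- Double Riemann sums of a uniformly continuous function against a signed measure converge to
its integral. -/
theorem tendsto_sum_mul_signedMeasure {X : Type*} [MeasurableSpace X] [PseudoEMetricSpace X]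
    {A B D : Set X} (γ : SignedMeasure (X × X)) {c : X × X → ℝ}
    (hc : UniformContinuousOn c (D ×ˢ D)) (hci : γ.Integrable c) (hAD : A ⊆ D) (hBD : B ⊆ D) :
    Tendsto (fun pq : TaggedPartition A × TaggedPartition B =>
      pq.1.sum fun x I => pq.2.sum fun y J => c (x, y) * γ (I ×ˢ J)) (fine A ×ˢ fine B)
      (𝓝 (∫ᵛ w in A ×ˢ B, c w ∂•γ)) := by
  have := isFiniteMeasure_variation γ
  refine Metric.tendsto_nhds.2 fun ε hε => ?_
  set V := γ.variation.real univ
  have hV : 0 ≤ V := measureReal_nonneg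
  -- The oscillation allowed on each cell; `V + 1` keeps the denominator positive when the variation
  -- vanishes.
  have hη : 0 < ε / (2 * (V + 1)) := by positivity
  obtain ⟨δ, hδ, h⟩ := EMetric.uniformContinuousOn_iff.1 hc _ (ENNReal.ofReal_pos.2 hη)
  obtain ⟨t, ht0, htδ⟩ := exists_between hδ
  filter_upwards [prod_mem_prod (eventually_mesh_le ht0) (eventually_mesh_le ht0)]
    with ⟨p, q⟩ ⟨hp, hq⟩
  let s : Fin p.card × Fin q.card → Set (X × X) := fun i => p.cell i.1 ×ˢ q.cell i.2
  have hs : ∀ i, MeasurableSet (s i) := fun i =>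
    (p.measurableSet_cell i.1).prod (q.measurableSet_cell i.2)
  have hd : Pairwise (Disjoint on s) := fun i j hij => by
    refine disjoint_left.2 fun w hw hw' => hij (Prod.ext ?_ ?_)
    · by_contra hne
      exact disjoint_left.1 (p.disjoint_cell hne) hw.1 hw'.1
    · by_contra hne
      exact disjoint_left.1 (q.disjoint_cell hne) hw.2 hw'.2
  have hU : (⋃ i, s i) = A ×ˢ B := by
    have e : (⋃ i, s i) = (⋃ j, p.cell j) ×ˢ ⋃ k, q.cell k := by
      ext w
      simp [s]
    rw [e, p.iUnion_cell, q.iUnion_cell]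
  have hle : ∀ i, ‖c (p.tag i.1, q.tag i.2) * γ (s i) - ∫ᵛ w in s i, c w ∂•γ‖ ≤
      ε / (2 * (V + 1)) * γ.variation.real (s i) := fun i => by
    have e : c (p.tag i.1, q.tag i.2) * γ (s i) - ∫ᵛ w in s i, c w ∂•γ =
        ∫ᵛ w in s i, (c (p.tag i.1, q.tag i.2) - c w) ∂•γ := by
      have := isFiniteMeasure_variation (γ.restrict (s i))
      rw [VectorMeasure.integral_fun_sub (integrable_const _) hci.restrict,
        VectorMeasure.setIntegral_const]
      simp
    rw [e]
    refine (VectorMeasure.norm_setIntegral_le_of_norm_le_const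
      (C := ε / (2 * (V + 1))) fun w hw => ?_).trans ?_
    · have hlt := h (a := (p.tag i.1, q.tag i.2))
        ⟨hAD (p.tag_mem_set _), hBD (q.tag_mem_set _)⟩ (b := w)
        ⟨hAD (p.cell_subset _ hw.1), hBD (q.cell_subset _ hw.2)⟩
        (lt_of_le_of_lt (max_le ((p.edist_tag_le hw.1).trans hp)
          ((q.edist_tag_le hw.2).trans hq)) htδ)
      rw [edist_dist, ENNReal.ofReal_lt_ofReal_iff hη, Real.dist_eq] at hlt
      exact hlt.le
    · refine mul_le_mul_of_nonneg_right ?_ measureReal_nonneg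
      exact mul_le_of_le_one_right hη.le (ContinuousLinearMap.opNorm_lsmul_le (𝕜 := ℝ))
  have e1 : (p.sum fun x I => q.sum fun y J => c (x, y) * γ (I ×ˢ J)) =
      ∑ i : Fin p.card × Fin q.card, c (p.tag i.1, q.tag i.2) * γ (s i) := by
    rw [Fintype.sum_prod_type]
    rfl
  rw [e1, dist_eq_norm, ← hU, VectorMeasure.setIntegral_iUnion_fintype hs hd
    (fun i => hci.restrict), ← Finset.sum_sub_distrib]
  calc _ ≤ ∑ i, ε / (2 * (V + 1)) * γ.variation.real (s i) :=
        (norm_sum_le _ _).trans (Finset.sum_le_sum fun i _ => hle i)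
    _ = ε / (2 * (V + 1)) * γ.variation.real (⋃ i, s i) := by
        rw [← Finset.mul_sum, measureReal_iUnion_fintype hd hs]
    _ ≤ ε / (2 * (V + 1)) * V := mul_le_mul_of_nonneg_left (measureReal_mono (subset_univ _)) hη.le
    _ < ε := by
        rw [div_mul_eq_mul_div, div_lt_iff₀ (by positivity)]
        nlinarith

/-- Loève's criterion: the squared distance of two terms tends to c − 2c + c = 0. -/
theorem exists_tendsto_of_tendsto_inner {α H : Type*} [NormedAddCommGroup H]
    [InnerProductSpace ℝ H] [CompleteSpace H] {l : Filter α} [l.NeBot] {S : α → H} {c : ℝ}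
    (h : Tendsto (fun p : α × α => inner ℝ (S p.1) (S p.2)) (l ×ˢ l) (𝓝 c)) :
    ∃ a, Tendsto S l (𝓝 a) := by
  refine cauchy_map_iff_exists_tendsto.1 (cauchy_map_iff.2 ⟨inferInstance, ?_⟩)
  rw [uniformity_eq_comap_nhds_zero, tendsto_comap_iff, tendsto_zero_iff_norm_tendsto_zero]
  have hdiag : Tendsto (fun p : α => inner ℝ (S p) (S p)) l (𝓝 c) :=
    h.comp (tendsto_id.prodMk tendsto_id)
  have h2 : Tendsto (fun p : α × α => ‖S p.2 - S p.1‖ ^ 2) (l ×ˢ l) (𝓝 0) := by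
    have := ((hdiag.comp tendsto_snd).sub (h.const_mul 2)).add (hdiag.comp tendsto_fst)
    refine (this.congr fun p => ?_).trans (by ring_nf; exact le_rfl)
    simp only [Function.comp_apply]
    rw [norm_sub_sq_real, real_inner_self_eq_norm_sq, real_inner_self_eq_norm_sq,
      real_inner_comm]
  simpa [Function.comp_def] using h2.sqrt

theorem tendsto_measure_diff_biUnion_finset {X : Type*} [MeasurableSpace X] (ρ : Measure X)
    [IsFiniteMeasure ρ] {A : ℕ → Set X} (hA : ∀ i, MeasurableSet (A i)) :
    Tendsto (fun s : Finset ℕ => ρ ((⋃ i, A i) \ ⋃ i ∈ s, A i)) atTop (𝓝 0) := by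
  have h := tendsto_measure_iInter_atTop (μ := ρ)
    (s := fun s : Finset ℕ => (⋃ i, A i) \ ⋃ i ∈ s, A i)
    (fun s => ((MeasurableSet.iUnion hA).diff
      (s.measurableSet_biUnion fun i _ => hA i)).nullMeasurableSet)
    (fun s t hst => sdiff_subset_sdiff_right (biUnion_subset_biUnion_left hst))
    ⟨∅, measure_ne_top _ _⟩
  have e : (⋂ s : Finset ℕ, (⋃ i, A i) \ ⋃ i ∈ s, A i) = ∅ := by
    refine eq_empty_of_forall_notMem fun x hx => ?_
    have h0 := mem_iInter.1 hx
    obtain ⟨i, hi⟩ := mem_iUnion.1 (h0 ∅).1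
    exact (h0 {i}).2 (by simpa using hi)
  simpa [e, Function.comp_def] using h

theorem tendsto_measure_prod_diff_biUnion_finset {X : Type*} [MeasurableSpace X]
    (ρ : Measure (X × X)) [IsFiniteMeasure ρ] {A : ℕ → Set X} (hA : ∀ i, MeasurableSet (A i)) :
    Tendsto (fun s : Finset ℕ => ρ (((⋃ i, A i) \ ⋃ i ∈ s, A i) ×ˢ ((⋃ i, A i) \ ⋃ i ∈ s, A i)))
      atTop (𝓝 0) := by
  refine tendsto_of_tendsto_of_tendsto_of_le_of_le tendsto_const_nhds
    (tendsto_measure_diff_biUnion_finset (ρ.map Prod.fst) hA) (fun _ => bot_le) fun s => ?_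
  simp only
  rw [Measure.map_apply measurable_fst ((MeasurableSet.iUnion hA).diff
      (s.measurableSet_biUnion fun i _ => hA i))]
  exact measure_mono fun w hw => hw.1

/-! ### Windows and products of real measures. -/

section RealMeasure

variable {X Y : Type*} [MeasurableSpace X] [Bornology X] [MeasurableSpace Y] [Bornology Y]

theorem RealMeasureOn.window_apply {D : Set X} (μ : RealMeasureOn D) {A S : Set X}
    (hA : MeasurableSet A) (hb : IsBounded A) (hAD : A ⊆ D) (hS : MeasurableSet S) :
    μ.window A S = μ (S ∩ A) := by
  classical
  rw [window, dif_pos ⟨hA, hb, hAD⟩]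
  change (if MeasurableSet S then μ (S ∩ A) else 0) = _
  rw [if_pos hS]

theorem RealMeasureOn.window_restrict {D : Set X} (μ : RealMeasureOn D) {A B : Set X}
    (hA : MeasurableSet A) (hb : IsBounded A) (hAD : A ⊆ D) (hB : MeasurableSet B) (hBA : B ⊆ A) :
    (μ.window A).restrict B = μ.window B := by
  ext S hS
  rw [VectorMeasure.restrict_apply _ hB hS, μ.window_apply hA hb hAD (hS.inter hB),
    μ.window_apply hB (hb.subset hBA) (hBA.trans hAD) hS, inter_assoc, inter_eq_left.2 hBA]

/-- Nonemptiness is what makes the projections of I × J equal to I and J, so that the windows are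
the closures of I and J. -/
theorem RealMeasureOn.prod_apply [TopologicalSpace X] [OpensMeasurableSpace X]
    [TopologicalSpace Y] [OpensMeasurableSpace Y] (μ : RealMeasureOn (univ : Set X))
    (ν : RealMeasureOn (univ : Set Y)) {I : Set X} {J : Set Y} (hI : MeasurableSet I)
    (hJ : MeasurableSet J) (hIb : IsBounded (closure I)) (hJb : IsBounded (closure J))
    (hI0 : I.Nonempty) (hJ0 : J.Nonempty) : μ.prod ν (I ×ˢ J) = μ I * ν J := by
  have := isFiniteMeasure_variation (μ.window (closure I))
  rw [RealMeasureOn.prod, fst_image_prod _ hJ0, snd_image_prod hI0, VectorMeasure.prod_apply,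
    μ.window_apply isClosed_closure.measurableSet hIb (subset_univ _) hI,
    ν.window_apply isClosed_closure.measurableSet hJb (subset_univ _) hJ,
    inter_eq_left.2 subset_closure, inter_eq_left.2 subset_closure]
  rfl

end RealMeasure

/-! ### Second-order variables as vectors of L². -/

section MeanSquare

variable {Ω : Type*} [MeasurableSpace Ω] {P : Measure Ω} {X : Type*}

/-- The value at `x` of a second-order process, as an element of `L²`. -/
def MSProcess.toL2 [TopologicalSpace X] (Z : MSProcess P X) (x : X) : Lp ℝ 2 P :=
  (Z.memLp x).toLp (Z x)

theorem MSProcess.continuous_toL2 [TopologicalSpace X] (Z : MSProcess P X) :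
    Continuous Z.toL2 := by
  refine continuous_iff_continuousAt.2 fun x₀ => ?_
  refine tendsto_iff_edist_tendsto_0.2 ?_
  simp only [MSProcess.toL2, Lp.edist_toLp_toLp]
  exact Z.tendsto_L2 x₀

theorem inner_L2_eq_integral_mul (f g : Lp ℝ 2 P) : inner ℝ f g = ∫ ω, f ω * g ω ∂P := by
  rw [L2.inner_def]
  exact integral_congr_ae (Eventually.of_forall fun ω => by simp [mul_comm])

theorem MSProcess.inner_toL2_left [TopologicalSpace X] (Z : MSProcess P X) (x : X)
    (f : Lp ℝ 2 P) : inner ℝ (Z.toL2 x) f = ∫ ω, Z x ω * f ω ∂P := by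
  rw [inner_L2_eq_integral_mul]
  refine integral_congr_ae ?_
  filter_upwards [(Z.memLp x).coeFn_toLp] with ω h
  rw [MSProcess.toL2, h]

theorem MSProcess.inner_toL2 [TopologicalSpace X] (Z : MSProcess P X) (x y : X) :
    inner ℝ (Z.toL2 x) (Z.toL2 y) = ∫ ω, Z x ω * Z y ω ∂P := by
  rw [inner_toL2_left]
  refine integral_congr_ae ?_
  filter_upwards [(Z.memLp y).coeFn_toLp] with ω h
  rw [MSProcess.toL2, h]

open Classical in
/-- The product `Z(x) M(A)` as an element of `L²`, or `0` if it is not square integrable. -/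
def productL2 [TopologicalSpace X] [MeasurableSpace X] [Bornology X]
    (Z : MSProcess P X) (M : RandomMeasure P (univ : Set X)) (x : X) (A : Set X) : Lp ℝ 2 P :=
  if h : MemLp (fun ω => Z x ω * M A ω) 2 P then h.toLp _ else 0

section Gaussian

variable [TopologicalSpace X] [MeasurableSpace X] [Bornology X]
  {Z : MSProcess P X} {M : RandomMeasure P (univ : Set X)} {A B : Set X}

theorem memLp_mul_of_jointlyGaussian (hG : JointlyGaussian Z M) (x : X)
    (hA : MeasurableSet A) (hb : IsBounded A) : MemLp (fun ω => Z x ω * M A ω) 2 P :=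
  memLp_mul_of_isGaussianProcess hG (Sum.inl x) (Sum.inr ⟨A, hA, hb⟩)

theorem coeFn_productL2 (hG : JointlyGaussian Z M) (x : X)
    (hA : MeasurableSet A) (hb : IsBounded A) :
    productL2 Z M x A =ᵐ[P] fun ω => Z x ω * M A ω := by
  rw [productL2, dif_pos (memLp_mul_of_jointlyGaussian hG x hA hb)]
  exact MemLp.coeFn_toLp _

theorem integral_productL2 (hG : JointlyGaussian Z M) (x : X)
    (hA : MeasurableSet A) (hb : IsBounded A) :
    ∫ ω, productL2 Z M x A ω ∂P = inner ℝ (Z.toL2 x) (M A) := by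
  rw [integral_congr_ae (coeFn_productL2 hG x hA hb), Z.inner_toL2_left]

/-- The three pairings of Isserlis' formula. They lead, in order, to the product of the means, the
integral of C_Z against C_M, and the second-order kernel. -/
theorem inner_productL2 (hG : JointlyGaussian Z M) (hZ : ∀ x, ∫ ω, Z x ω ∂P = 0)
    (hM : ∀ A, MeasurableSet A → IsBounded A → ∫ ω, M A ω ∂P = 0) (x y : X)
    (hA : MeasurableSet A) (hAb : IsBounded A) (hB : MeasurableSet B) (hBb : IsBounded B) :
    inner ℝ (productL2 Z M x A) (productL2 Z M y B) =
      inner ℝ (Z.toL2 x) (M A) * inner ℝ (Z.toL2 y) (M B)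
      + inner ℝ (Z.toL2 x) (Z.toL2 y) * inner ℝ (M A) (M B)
      + inner ℝ (Z.toL2 y) (M A) * inner ℝ (Z.toL2 x) (M B) := by
  have h := integral_mul_four_of_isGaussianProcess hG
    (by rintro (x | ⟨A, hA, hb⟩); exacts [hZ x, hM A hA hb])
    (Sum.inl x) (Sum.inr ⟨A, hA, hAb⟩) (Sum.inl y) (Sum.inr ⟨B, hB, hBb⟩)
  simp only [Sum.elim_inl, Sum.elim_inr] at h
  have e : inner ℝ (productL2 Z M x A) (productL2 Z M y B) =
      ∫ ω, (Z x ω * M A ω) * (Z y ω * M B ω) ∂P := by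
    rw [inner_L2_eq_integral_mul]
    refine integral_congr_ae ?_
    filter_upwards [coeFn_productL2 hG x hA hAb, coeFn_productL2 hG y hB hBb] with ω h1 h2
    rw [h1, h2]
  rw [e, h, Z.inner_toL2_left, Z.inner_toL2_left, Z.inner_toL2, inner_L2_eq_integral_mul,
    Z.inner_toL2_left, Z.inner_toL2_left]
  simp only [mul_comm (M A _) (Z y _)]
  ring

end Gaussian

section CrossCov

variable [IsProbabilityMeasure P] [TopologicalSpace X] [MeasurableSpace X] [Bornology X]
  {Z : MSProcess P X} {M : RandomMeasure P (univ : Set X)}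

theorem crossCov_eq_inner (hZ : ∀ x, ∫ ω, Z x ω ∂P = 0) (x : X) (A : Set X) :
    crossCov Z M x A = inner ℝ (Z.toL2 x) (M A) := by
  change cov[Z x, M A; P] = _
  rw [covariance_L2_eq_inner (Z.memLp x), hZ, zero_mul, sub_zero]
  rfl

omit [MeasurableSpace X] [Bornology X] in
theorem covariance_eq_inner_toL2 (hZ : ∀ x, ∫ ω, Z x ω ∂P = 0) (x y : X) :
    cov[Z x, Z y; P] = inner ℝ (Z.toL2 x) (Z.toL2 y) := by
  rw [covariance_eq_sub (Z.memLp x) (Z.memLp y), hZ, zero_mul, sub_zero, Z.inner_toL2]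
  rfl

theorem covariance_L2 (f g : Lp ℝ 2 P) :
    cov[f, g; P] = inner ℝ f g - (∫ ω, f ω ∂P) * ∫ ω, g ω ∂P := by
  rw [covariance_eq_sub (Lp.memLp f) (Lp.memLp g), inner_L2_eq_integral_mul]
  rfl

omit [TopologicalSpace X] in
theorem RandomMeasure.cov_window_prod
    (hM : ∀ A, MeasurableSet A → IsBounded A → ∫ ω, M A ω ∂P = 0) {A B D : Set X}
    (hD : MeasurableSet D) (hDb : IsBounded D) (hA : MeasurableSet A) (hB : MeasurableSet B) :
    M.cov.window (D ×ˢ D) (A ×ˢ B) = inner ℝ (M (A ∩ D)) (M (B ∩ D)) := by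
  rw [M.cov.window_apply (hD.prod hD) (hDb.prod hDb) (prod_mono (subset_univ _) (subset_univ _))
    (hA.prod hB), prod_inter_prod,
    M.cov_prod _ _ (hA.inter hD) (hDb.subset inter_subset_right) (subset_univ _)
      (hB.inter hD) (hDb.subset inter_subset_right) (subset_univ _), covariance_L2,
    hM _ (hA.inter hD) (hDb.subset inter_subset_right), zero_mul, sub_zero]

omit [IsProbabilityMeasure P] [TopologicalSpace X] in
theorem RandomMeasure.apply_union {D : Set X} (M : RandomMeasure P D) {A B : Set X}
    (hA : MeasurableSet A)
    (hB : MeasurableSet B) (hAB : Disjoint A B) (hb : IsBounded (A ∪ B)) (hD : A ∪ B ⊆ D) :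
    M (A ∪ B) = M A + M B := by
  let F : ℕ → Set X := fun i => if i = 0 then A else if i = 1 then B else ∅
  have hF0 : M ∅ = 0 := by
    have h := M.hasSum_iUnion' (fun _ => ∅) (fun _ => MeasurableSet.empty)
      (fun i j _ => disjoint_bot_left) (by simp) (by simp)
    have h2 := h.summable.tendsto_atTop_zero
    simpa using tendsto_nhds_unique tendsto_const_nhds h2
  have hU : (⋃ i, F i) = A ∪ B := by
    ext x
    simp only [mem_iUnion, mem_union]
    constructor
    · rintro ⟨i, hi⟩
      by_cases h0 : i = 0
      · left; simpa [F, h0] using hi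
      · by_cases h1 : i = 1
        · right; simpa [F, h1] using hi
        · simp [F, h0, h1] at hi
    · rintro (h | h)
      exacts [⟨0, by simpa [F] using h⟩, ⟨1, by simpa [F] using h⟩]
  have h := M.hasSum_iUnion' F
    (fun i => by
      by_cases h0 : i = 0
      · simpa [F, h0] using hA
      · by_cases h1 : i = 1 <;> simp [F, h0, h1, hB])
    (fun i j hij => by
      change Disjoint (F i) (F j)
      by_cases h0 : i = 0 <;> by_cases h1 : i = 1 <;> by_cases h2 : j = 0 <;> by_cases h3 : j = 1 <;>
        simp_all [F, hAB.symm])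
    (by rwa [hU]) (by rwa [hU])
  have h2 : HasSum (fun i => M (F i)) (∑ i ∈ Finset.range 2, M (F i)) :=
    hasSum_sum_of_ne_finset_zero fun i hi => by
      have h0 : i ≠ 0 := fun h => hi (by simp [h])
      have h1 : i ≠ 1 := fun h => hi (by simp [h])
      simp [F, h0, h1, hF0]
  rw [← hU, h.unique h2]
  simp [Finset.sum_range_succ, F]

end CrossCov

end MeanSquare

/-! ### Convergence of the stochastic Riemann sums. -/

section StochasticIntegral

variable {Ω : Type*} [MeasurableSpace Ω] {P : Measure Ω} [IsProbabilityMeasure P]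
  {X : Type*} [MeasurableSpace X] [PseudoMetricSpace X] [OpensMeasurableSpace X]
  {Z : MSProcess P X} {M : RandomMeasure P (univ : Set X)} {D : Set X}

/-- The second-order kernel of `Z` and `M` has double Riemann sums that converge to the values of a
measure with an integrable density. -/
theorem exists_integrable_tendsto_sum_inner_mul
    (hM : ∀ A, MeasurableSet A → IsBounded A → ∫ ω, M A ω ∂P = 0) (hD : MeasurableSet D)
    (hDc : IsCompact D) : ∃ (ρ : Measure (X × X)) (_ : IsFiniteMeasure ρ) (k : X × X → ℝ),
      Integrable k ρ ∧ ∀ A B, MeasurableSet A → A ⊆ D → MeasurableSet B → B ⊆ D →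
      Tendsto (fun pq : TaggedPartition A × TaggedPartition B =>
        pq.1.sum fun x I => pq.2.sum fun y J =>
          inner ℝ (Z.toL2 y) (M I) * inner ℝ (Z.toL2 x) (M J))
        (fine A ×ˢ fine B) (𝓝 (∫ w in A ×ˢ B, k w ∂ρ)) := by
  have hDb := hDc.isBounded
  obtain ⟨r, hr⟩ := exists_density_of_inner_eq (fun A => M (A ∩ D)) (M.cov.window (D ×ˢ D))
    (fun A B hA hB hAB => by
      rw [union_inter_distrib_right]
      exact M.apply_union (hA.inter hD) (hB.inter hD)
        (hAB.mono inter_subset_left inter_subset_left)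
        (hDb.subset (union_subset inter_subset_right inter_subset_right)) (subset_univ _))
    (fun A B hA hB => M.cov_window_prod hM hD hDb hA hB)
  -- Mean-square continuity of Z passes to the densities through the bounded operator `r`;
  -- compactness of D makes it uniform.
  have hg : UniformContinuousOn (fun x => r (Z.toL2 x)) D :=
    hDc.uniformContinuousOn_of_continuous (r.continuous.comp Z.continuous_toL2).continuousOn
  obtain ⟨k, hk, hlim⟩ := exists_integrable_tendsto_tensorSum hg hD hDc.totallyBounded
  refine ⟨_, inferInstance, k, hk, fun A B hA hAD hB hBD => (hlim A B hA hAD hB hBD).congr ?_⟩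
  rintro ⟨p, q⟩
  refine Finset.sum_congr rfl fun j _ => Finset.sum_congr rfl fun i _ => ?_
  dsimp only
  rw [hr _ _ (p.measurableSet_cell j), hr _ _ (q.measurableSet_cell i),
    inter_eq_left.2 ((p.cell_subset j).trans hAD), inter_eq_left.2 ((q.cell_subset i).trans hBD)]

-- The covariance function is bounded on the compact D × D, and the window puts no mass elsewhere.
omit [IsProbabilityMeasure P] in
theorem integrable_covariance_window [SecondCountableTopology X] (hDc : IsCompact D)
    (hD : MeasurableSet D) :
    (M.cov.window (D ×ˢ D)).Integrable
      (fun w : X × X => (inner ℝ (Z.toL2 w.1) (Z.toL2 w.2) : ℝ)) := by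
  set γ := M.cov.window (D ×ˢ D)
  have := isFiniteMeasure_variation γ
  have hγ : γ.restrict (D ×ˢ D) = γ :=
    M.cov.window_restrict (hD.prod hD) (hDc.isBounded.prod hDc.isBounded)
      (prod_mono (subset_univ _) (subset_univ _)) (hD.prod hD) Subset.rfl
  have hc : Continuous fun w : X × X => (inner ℝ (Z.toL2 w.1) (Z.toL2 w.2) : ℝ) :=
    (Z.continuous_toL2.comp continuous_fst).inner (Z.continuous_toL2.comp continuous_snd)
  obtain ⟨b, hb⟩ := ((hDc.prod hDc).image hc).isBounded.exists_norm_le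
  have h : IntegrableOn (fun w : X × X => (inner ℝ (Z.toL2 w.1) (Z.toL2 w.2) : ℝ)) (D ×ˢ D)
      γ.variation := by
    refine Integrable.of_bound hc.aestronglyMeasurable b ?_
    filter_upwards [ae_restrict_mem (hD.prod hD)] with w hw
    exact hb _ (mem_image_of_mem _ hw)
  rw [VectorMeasure.Integrable, ← hγ, VectorMeasure.variation_restrict (hD.prod hD)]
  exact h

omit [OpensMeasurableSpace X] in
theorem integral_sum_productL2 (hG : JointlyGaussian Z M) (hZ : ∀ x, ∫ ω, Z x ω ∂P = 0)
    {A : Set X} (hA : IsBounded A) (p : TaggedPartition A) :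
    ∫ ω, (p.sum (productL2 Z M)) ω ∂P = p.sum fun x => crossCov Z M x := by
  rw [integral_L2_eq_inner, TaggedPartition.sum, inner_sum]
  refine Finset.sum_congr rfl fun j _ => ?_
  dsimp only
  rw [← integral_L2_eq_inner, integral_productL2 hG _ (p.measurableSet_cell j)
    (hA.subset (p.cell_subset j)), crossCov_eq_inner hZ]

/-- The covariance structure of the stochastic Riemann sums. -/
theorem tendsto_inner_sum_productL2 [SecondCountableTopology X] (hG : JointlyGaussian Z M)
    (hZ : ∀ x, ∫ ω, Z x ω ∂P = 0)
    (hM : ∀ A, MeasurableSet A → IsBounded A → ∫ ω, M A ω ∂P = 0) (hDc : IsCompact D)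
    (hD : MeasurableSet D) {l : ℝ} (hl : IsSelfIntegral (fun x => crossCov Z M x) D l)
    {A B : Set X} (hA : MeasurableSet A) (hAD : A ⊆ D) (hB : MeasurableSet B) (hBD : B ⊆ D)
    {q : ℝ} (hq : Tendsto (fun pq : TaggedPartition A × TaggedPartition B =>
        pq.1.sum fun x I => pq.2.sum fun y J =>
          inner ℝ (Z.toL2 y) (M I) * inner ℝ (Z.toL2 x) (M J)) (fine A ×ˢ fine B) (𝓝 q)) :
    Tendsto (fun pq : TaggedPartition A × TaggedPartition B =>
        (inner ℝ (pq.1.sum (productL2 Z M)) (pq.2.sum (productL2 Z M)) : ℝ)) (fine A ×ˢ fine B)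
      (𝓝 (selfIntegral (fun x => crossCov Z M x) A * selfIntegral (fun x => crossCov Z M x) B
        + (∫ᵛ w in A ×ˢ B, (inner ℝ (Z.toL2 w.1) (Z.toL2 w.2) : ℝ) ∂•(M.cov.window (D ×ˢ D)))
        + q)) := by
  have hc : Continuous fun w : X × X => (inner ℝ (Z.toL2 w.1) (Z.toL2 w.2) : ℝ) :=
    (Z.continuous_toL2.comp continuous_fst).inner (Z.continuous_toL2.comp continuous_snd)
  have h1 := tendsto_selfIntegral hD hDc.totallyBounded hl hA hAD
  have h2 := tendsto_selfIntegral hD hDc.totallyBounded hl hB hBD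
  have h3 := tendsto_sum_mul_signedMeasure (A := A) (B := B) (M.cov.window (D ×ˢ D))
    ((hDc.prod hDc).uniformContinuousOn_of_continuous hc.continuousOn)
    (integrable_covariance_window hDc hD) hAD hBD
  -- One limit for each pairing in `inner_productL2`.
  refine ((((h1.comp tendsto_fst).mul (h2.comp tendsto_snd)).add h3).add hq).congr ?_
  rintro ⟨p, p'⟩
  simp only [Function.comp_apply, TaggedPartition.sum, Finset.sum_mul_sum,
    ← Finset.sum_add_distrib]
  rw [sum_inner]
  refine Finset.sum_congr rfl fun j _ => ?_
  rw [inner_sum]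
  refine Finset.sum_congr rfl fun i _ => ?_
  have hj := (p.cell_subset j).trans hAD
  have hi := (p'.cell_subset i).trans hBD
  rw [inner_productL2 hG hZ hM _ _ (p.measurableSet_cell j) (hDc.isBounded.subset hj)
    (p'.measurableSet_cell i) (hDc.isBounded.subset hi), crossCov_eq_inner hZ,
    crossCov_eq_inner hZ, M.cov_window_prod hM hD hDc.isBounded (p.measurableSet_cell j)
      (p'.measurableSet_cell i), inter_eq_left.2 hj, inter_eq_left.2 hi]

omit [IsProbabilityMeasure P] [OpensMeasurableSpace X] in
theorem isStochasticIntegral_iff (hG : JointlyGaussian Z M) {A : Set X} (hA : IsBounded A)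
    {I : Lp ℝ 2 P} : IsStochasticIntegral Z M A I ↔ ∀ R : RiemannSystem A,
      Tendsto (fun n => (R.partition n).sum (productL2 Z M)) atTop (𝓝 I) := by
  refine forall_congr' fun R => ?_
  rw [tendsto_iff_edist_tendsto_0]
  refine tendsto_congr fun n => ?_
  rw [Lp.edist_def]
  refine eLpNorm_congr_ae ?_
  have h : ∀ᵐ ω ∂P, ∀ j, productL2 Z M (R.tag n j) (R.cell n j) ω =
      Z (R.tag n j) ω * M (R.cell n j) ω := ae_all_iff.2 fun j =>
    coeFn_productL2 hG _ (R.measurableSet_cell n j)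
      (hA.subset ((R.partition n).cell_subset j))
  have h2 : ⇑((R.partition n).sum (productL2 Z M)) =ᵐ[P]
      ∑ j, ⇑(productL2 Z M (R.tag n j) (R.cell n j)) := Lp.coeFn_finsetSum _ _
  filter_upwards [h, h2] with ω h h2
  rw [Pi.sub_apply, h2, Finset.sum_apply]
  simp only [h]

-- The tails are indexed by finite sets of indices because `HasSum` is unconditional summation.
omit [OpensMeasurableSpace X] [PseudoMetricSpace X] in
theorem hasSum_of_tendsto_diff_biUnion {V : Type*} [NormedAddCommGroup V] {N : Set X → V}
    (hN : ∀ A B, MeasurableSet A → A ⊆ D → MeasurableSet B → B ⊆ D → Disjoint A B →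
      N (A ∪ B) = N A + N B) {A : ℕ → Set X} (hA : ∀ i, MeasurableSet (A i))
    (hd : Pairwise (Disjoint on A)) (hAD : (⋃ i, A i) ⊆ D)
    (hlim : Tendsto (fun s : Finset ℕ => N ((⋃ i, A i) \ ⋃ i ∈ s, A i)) atTop (𝓝 0)) :
    HasSum (fun i => N (A i)) (N (⋃ i, A i)) := by
  classical
  have hsm : ∀ s : Finset ℕ, MeasurableSet (⋃ i ∈ s, A i) := fun s =>
    s.measurableSet_biUnion fun i _ => hA i
  have hsU : ∀ s : Finset ℕ, (⋃ i ∈ s, A i) ⊆ ⋃ i, A i := fun s =>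
    iUnion₂_subset fun i _ => subset_iUnion A i
  have h0 : N ∅ = 0 := by
    simpa using hN ∅ ∅ .empty (empty_subset _) .empty (empty_subset _) disjoint_bot_left
  have hsum : ∀ s : Finset ℕ, N (⋃ i ∈ s, A i) = ∑ i ∈ s, N (A i) := fun s => by
    induction s using Finset.induction_on with
    | empty => simp [h0]
    | insert a s ha ih =>
      rw [Finset.set_biUnion_insert, Finset.sum_insert ha, ← ih]
      refine hN _ _ (hA a) ((subset_iUnion A a).trans hAD) (hsm s) ((hsU s).trans hAD) ?_
      exact disjoint_iUnion₂_right.2 fun i hi => hd fun h => ha (h ▸ hi)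
  have h := hlim.const_sub (N (⋃ i, A i))
  rw [sub_zero] at h
  refine h.congr fun s => ?_
  rw [← hsum, sub_eq_iff_eq_add, ← hN _ _ (hsm s) ((hsU s).trans hAD)
    ((MeasurableSet.iUnion hA).diff (hsm s)) (sdiff_subset.trans hAD) disjoint_sdiff_right,
    union_sdiff_cancel (hsU s)]

end StochasticIntegral

theorem hasSum_setIntegral_add_setIntegral {X : Type*} [MeasurableSpace X] {γ : SignedMeasure X}
    {ρ : Measure X} {c k : X → ℝ} (hc : γ.Integrable c) (hk : Integrable k ρ) {E : ℕ → Set X}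
    (hE : ∀ i, MeasurableSet (E i)) (hd : Pairwise (Disjoint on E)) :
    HasSum (fun i => (∫ᵛ w in E i, c w ∂•γ) + ∫ w in E i, k w ∂ρ)
      ((∫ᵛ w in ⋃ i, E i, c w ∂•γ) + ∫ w in ⋃ i, E i, k w ∂ρ) := by
  have h : HasSum (fun i => ∫ᵛ w in E i, c w ∂•γ) (∫ᵛ w in ⋃ i, E i, c w ∂•γ) :=
    VectorMeasure.hasSum_setIntegral_iUnion hE hd hc.integrableOn
  exact h.add (hasSum_integral_iUnion hE hd hk.integrableOn)

/-! ### The stochastic integral as a random measure. -/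

section StochasticIntegral

variable {Ω : Type*} [MeasurableSpace Ω] {P : Measure Ω} [IsProbabilityMeasure P]
  {X : Type*} [MeasurableSpace X] [PseudoMetricSpace X] [OpensMeasurableSpace X]
  {Z : MSProcess P X} {M : RandomMeasure P (univ : Set X)} {D : Set X}

/-- The stochastic integral `∫_A Z dM`, with a junk value if it does not exist. -/
def stochasticIntegral (Z : MSProcess P X) (M : RandomMeasure P (univ : Set X)) (A : Set X) :
    Lp ℝ 2 P :=
  limUnder (fine A) fun p => p.sum (productL2 Z M)

/-- Loève's criterion with B = A gives convergence; continuity of the inner product then gives the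
formula for all A, B. The pair `ρ`, `k` does not depend on A or B, so the last two terms come from
one measure on D × D. -/
theorem exists_tendsto_stochasticIntegral [SecondCountableTopology X] (hG : JointlyGaussian Z M)
    (hZ : ∀ x, ∫ ω, Z x ω ∂P = 0)
    (hM : ∀ A, MeasurableSet A → IsBounded A → ∫ ω, M A ω ∂P = 0) (hDc : IsCompact D)
    (hD : MeasurableSet D) {l : ℝ} (hl : IsSelfIntegral (fun x => crossCov Z M x) D l) :
    ∃ (ρ : Measure (X × X)) (_ : IsFiniteMeasure ρ) (k : X × X → ℝ), Integrable k ρ ∧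
      (∀ A, MeasurableSet A → A ⊆ D →
        Tendsto (fun p => p.sum (productL2 Z M)) (fine A) (𝓝 (stochasticIntegral Z M A))) ∧
      ∀ A B, MeasurableSet A → A ⊆ D → MeasurableSet B → B ⊆ D →
        Tendsto (fun pq : TaggedPartition A × TaggedPartition B =>
          pq.1.sum fun x I => pq.2.sum fun y J =>
            inner ℝ (Z.toL2 y) (M I) * inner ℝ (Z.toL2 x) (M J))
          (fine A ×ˢ fine B) (𝓝 (∫ w in A ×ˢ B, k w ∂ρ)) ∧
        inner ℝ (stochasticIntegral Z M A) (stochasticIntegral Z M B) =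
          selfIntegral (fun x => crossCov Z M x) A * selfIntegral (fun x => crossCov Z M x) B
          + ((∫ᵛ w in A ×ˢ B, (inner ℝ (Z.toL2 w.1) (Z.toL2 w.2) : ℝ)
            ∂•(M.cov.window (D ×ˢ D))) + ∫ w in A ×ˢ B, k w ∂ρ) := by
  obtain ⟨ρ, hρ, k, hk, hlim⟩ := exists_integrable_tendsto_sum_inner_mul (Z := Z) hM hD hDc
  have hN : ∀ A, MeasurableSet A → A ⊆ D →
      Tendsto (fun p => p.sum (productL2 Z M)) (fine A) (𝓝 (stochasticIntegral Z M A)) := by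
    intro A hA hAD
    have := neBot_fine hA (hDc.totallyBounded.subset hAD)
    exact tendsto_nhds_limUnder (exists_tendsto_of_tendsto_inner
      (tendsto_inner_sum_productL2 hG hZ hM hDc hD hl hA hAD hA hAD (hlim A A hA hAD hA hAD)))
  refine ⟨ρ, hρ, k, hk, hN, fun A B hA hAD hB hBD => ⟨hlim A B hA hAD hB hBD, ?_⟩⟩
  have := neBot_fine hA (hDc.totallyBounded.subset hAD)
  have := neBot_fine hB (hDc.totallyBounded.subset hBD)
  rw [← add_assoc]
  exact tendsto_nhds_unique
    (((hN A hA hAD).comp tendsto_fst).inner ((hN B hB hBD).comp tendsto_snd))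
    (tendsto_inner_sum_productL2 hG hZ hM hDc hD hl hA hAD hB hBD (hlim A B hA hAD hB hBD))

theorem integral_stochasticIntegral (hG : JointlyGaussian Z M) (hZ : ∀ x, ∫ ω, Z x ω ∂P = 0)
    (hDc : IsCompact D) (hD : MeasurableSet D) {l : ℝ}
    (hl : IsSelfIntegral (fun x => crossCov Z M x) D l) {A : Set X} (hA : MeasurableSet A)
    (hAD : A ⊆ D)
    (hN : Tendsto (fun p => p.sum (productL2 Z M)) (fine A) (𝓝 (stochasticIntegral Z M A))) :
    ∫ ω, stochasticIntegral Z M A ω ∂P = selfIntegral (fun x => crossCov Z M x) A := by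
  have := neBot_fine hA (hDc.totallyBounded.subset hAD)
  rw [integral_L2_eq_inner]
  refine tendsto_nhds_unique (tendsto_const_nhds.inner hN)
    ((tendsto_selfIntegral hD hDc.totallyBounded hl hA hAD).congr fun p => ?_)
  rw [← integral_L2_eq_inner, integral_sum_productL2 hG hZ (hDc.isBounded.subset hAD)]

omit [IsProbabilityMeasure P] in
theorem stochasticIntegral_union (hDt : TotallyBounded D)
    (hN : ∀ A, MeasurableSet A → A ⊆ D →
      Tendsto (fun p => p.sum (productL2 Z M)) (fine A) (𝓝 (stochasticIntegral Z M A)))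
    {A B : Set X} (hA : MeasurableSet A) (hAD : A ⊆ D) (hB : MeasurableSet B) (hBD : B ⊆ D)
    (hAB : Disjoint A B) :
    stochasticIntegral Z M (A ∪ B) = stochasticIntegral Z M A + stochasticIntegral Z M B := by
  have := neBot_fine hA (hDt.subset hAD)
  have := neBot_fine hB (hDt.subset hBD)
  have h := (hN (A ∪ B) (hA.union hB) (union_subset hAD hBD)).comp (tendsto_union hAB rfl)
  simp only [Function.comp_def, TaggedPartition.sum_union] at h
  exact tendsto_nhds_unique h (((hN A hA hAD).comp tendsto_fst).add
    ((hN B hB hBD).comp tendsto_snd))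

/-- The stochastic integrals form a random measure over `D`. -/
theorem exists_randomMeasure_stochasticIntegral [SecondCountableTopology X]
    (hG : JointlyGaussian Z M) (hZ : ∀ x, ∫ ω, Z x ω ∂P = 0)
    (hM : ∀ A, MeasurableSet A → IsBounded A → ∫ ω, M A ω ∂P = 0) (hDc : IsCompact D)
    (hD : MeasurableSet D) {l : ℝ} (hl : IsSelfIntegral (fun x => crossCov Z M x) D l) :
    ∃ N : RandomMeasure P D, ∀ A, MeasurableSet A → A ⊆ D →
      Tendsto (fun p => p.sum (productL2 Z M)) (fine A) (𝓝 (N A)) ∧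
      N.mean A = selfIntegral (fun x => crossCov Z M x) A ∧
      ∀ B, MeasurableSet B → B ⊆ D → ∃ q,
        Tendsto (fun pq : TaggedPartition A × TaggedPartition B =>
          pq.1.sum fun x I => pq.2.sum fun y J => crossCov Z M y I * crossCov Z M x J)
          (fine A ×ˢ fine B) (𝓝 q) ∧
        N.cov (A ×ˢ B) = M.cov.integralOver (A ×ˢ B) (fun p => cov[Z p.1, Z p.2; P]) + q := by
  obtain ⟨ρ, hρ, k, hk, hN, h⟩ := exists_tendsto_stochasticIntegral hG hZ hM hDc hD hl
  have hmean : ∀ A, MeasurableSet A → A ⊆ D → ∫ ω, stochasticIntegral Z M A ω ∂P =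
      selfIntegral (fun x => crossCov Z M x) A := fun A hA hAD =>
    integral_stochasticIntegral hG hZ hDc hD hl hA hAD (hN A hA hAD)
  have hci := integrable_covariance_window (Z := Z) (M := M) hDc hD
  have := isFiniteMeasure_variation (M.cov.window (D ×ˢ D))
  let N : RandomMeasure P D :=
    { toFun := stochasticIntegral Z M
      hasSum_iUnion' := fun A hA hd _ hAD => by
        refine hasSum_of_tendsto_diff_biUnion (D := D) (fun A B hA hAD hB hBD hAB =>
          stochasticIntegral_union hDc.totallyBounded hN hA hAD hB hBD hAB) hA hd hAD ?_
        have hm : ∀ s : Finset ℕ, MeasurableSet ((⋃ i, A i) \ ⋃ i ∈ s, A i) := fun s =>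
          (MeasurableSet.iUnion hA).diff (s.measurableSet_biUnion fun i _ => hA i)
        have hsD : ∀ s : Finset ℕ, ((⋃ i, A i) \ ⋃ i ∈ s, A i) ⊆ D := fun s =>
          sdiff_subset.trans hAD
        have h1 := tendsto_selfIntegral_diff_biUnion (crossCov Z M) hD hDc.totallyBounded hl
          hA hd hAD
        have h2 : Tendsto (fun s : Finset ℕ =>
            ∫ᵛ w in ((⋃ i, A i) \ ⋃ i ∈ s, A i) ×ˢ ((⋃ i, A i) \ ⋃ i ∈ s, A i),
              (inner ℝ (Z.toL2 w.1) (Z.toL2 w.2) : ℝ) ∂•(M.cov.window (D ×ˢ D))) atTop (𝓝 0) :=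
          hci.tendsto_setIntegral_nhds_zero
          (tendsto_measure_prod_diff_biUnion_finset (M.cov.window (D ×ˢ D)).variation hA)
        have h3 := hk.tendsto_setIntegral_nhds_zero
          (tendsto_measure_prod_diff_biUnion_finset ρ hA)
        -- The squared norm of the integral over a tail is the sum of these three terms, all
        -- vanishing in the limit.
        have h4 := (h1.mul h1).add (h2.add h3)
        rw [mul_zero, add_zero, add_zero] at h4
        have h5 := (h4.congr fun s => ((h _ _ (hm s) (hsD s) (hm s) (hsD s)).2).symm).sqrt
        rw [Real.sqrt_zero] at h5
        refine tendsto_zero_iff_norm_tendsto_zero.2 (h5.congr fun s => ?_)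
        rw [real_inner_self_eq_norm_sq, Real.sqrt_sq (norm_nonneg _)]
      cov :=
        { toFun := fun E => (∫ᵛ w in E, (inner ℝ (Z.toL2 w.1) (Z.toL2 w.2) : ℝ)
            ∂•(M.cov.window (D ×ˢ D))) + ∫ w in E, k w ∂ρ
          hasSum_iUnion' := fun E hE hd _ _ =>
            hasSum_setIntegral_add_setIntegral hci hk hE hd }
      cov_prod := fun A B hA _ hAD hB _ hBD => by
        -- The product of the means cancels the first Isserlis pairing.
        rw [covariance_L2, hmean A hA hAD, hmean B hB hBD, (h A B hA hAD hB hBD).2,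
          add_sub_cancel_left] }
  refine ⟨N, fun A hA hAD => ⟨hN A hA hAD, hmean A hA hAD, fun B hB hBD =>
    ⟨∫ w in A ×ˢ B, k w ∂ρ, ?_, ?_⟩⟩⟩
  · simpa only [crossCov_eq_inner hZ] using (h A B hA hAD hB hBD).1
  · change (∫ᵛ w in A ×ˢ B, (inner ℝ (Z.toL2 w.1) (Z.toL2 w.2) : ℝ) ∂•(M.cov.window (D ×ˢ D))) +
      ∫ w in A ×ˢ B, k w ∂ρ = _
    rw [RealMeasureOn.integralOver, M.cov.window_restrict (hD.prod hD)
      (hDc.isBounded.prod hDc.isBounded) (prod_mono (subset_univ _) (subset_univ _))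
      (hA.prod hB) (prod_mono hAD hBD)]
    simp only [covariance_eq_inner_toL2 hZ]

end StochasticIntegral

/-! ### The second-order kernel on rectangles, and the main theorem. -/

theorem secondOrderKernel_prod {X : Type*} [MeasurableSpace X] [PseudoMetricSpace X]
    [OpensMeasurableSpace X] (K : X → RealMeasureOn (univ : Set X)) (x y : X) {I J : Set X}
    (hI : MeasurableSet I) (hJ : MeasurableSet J) (hIb : IsBounded I) (hJb : IsBounded J)
    (hI0 : I.Nonempty) (hJ0 : J.Nonempty) :
    secondOrderKernel K (x, y) (I ×ˢ J) = K y I * K x J :=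
  (K y).prod_apply (K x) hI hJ (Metric.isBounded_closure_iff.2 hIb)
    (Metric.isBounded_closure_iff.2 hJb) hI0 hJ0

end SelfIntegral

end

theorem mainTheorem9 {Ω : Type*} [MeasurableSpace Ω] (P : Measure Ω) [IsProbabilityMeasure P]
    (d : ℕ)
    (Z : SelfIntegral.MSProcess P (EuclideanSpace ℝ (Fin d)))
    (M : SelfIntegral.RandomMeasure P (univ : Set (EuclideanSpace ℝ (Fin d))))
    (hZ : ∀ x, ∫ ω, Z x ω ∂P = 0)
    (hM : ∀ A, MeasurableSet A → IsBounded A → ∫ ω, M A ω ∂P = 0)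
    (hG : SelfIntegral.JointlyGaussian Z M)
    (D : Set (EuclideanSpace ℝ (Fin d))) (hD : IsCompact D)
    (hK : SelfIntegral.SelfIntegrable (fun x => SelfIntegral.crossCov Z M x) D)
    (hKtv : SelfIntegral.SelfIntegrable
      (SelfIntegral.tvKernel fun x => SelfIntegral.crossCov Z M x) D)
    (hK₂ : SelfIntegral.QuasiSelfIntegrable
      (SelfIntegral.secondOrderKernel (SelfIntegral.crossCov Z M)) D D)
    (hK₂tv : SelfIntegral.QuasiSelfIntegrable
      (SelfIntegral.tvKernel (SelfIntegral.secondOrderKernel (SelfIntegral.crossCov Z M))) D D) :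
    ∃ N : SelfIntegral.RandomMeasure P D,
      -- `N A` is the uniquely defined stochastic integral `∫_A Z dM`
      (∀ A, MeasurableSet A → A ⊆ D →
        SelfIntegral.IsStochasticIntegral Z M A (N A) ∧
        ∀ I, SelfIntegral.IsStochasticIntegral Z M A I → I = N A) ∧
      -- the mean measure is given by the self-integrals of the cross-covariance kernel
      (∀ A, MeasurableSet A → A ⊆ D →
        SelfIntegral.SelfIntegrable (fun x => SelfIntegral.crossCov Z M x) A ∧
        SelfIntegral.IsSelfIntegral (fun x => SelfIntegral.crossCov Z M x) A (N.mean A)) ∧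
      -- the covariance measure is given by the quasi-self-integrals of the second-order kernel
      (∀ A B, MeasurableSet A → A ⊆ D → MeasurableSet B → B ⊆ D →
        ∃ q : ℝ,
          SelfIntegral.IsQuasiSelfIntegral
            (SelfIntegral.secondOrderKernel (SelfIntegral.crossCov Z M)) A B q ∧
          (∀ q', SelfIntegral.IsQuasiSelfIntegral
            (SelfIntegral.secondOrderKernel (SelfIntegral.crossCov Z M)) A B q' → q' = q) ∧
          N.cov (A ×ˢ B) =
            M.cov.integralOver (A ×ˢ B) (fun p => cov[Z p.1, Z p.2; P]) + q) := by
  have hDm := hD.measurableSet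
  have ht := hD.totallyBounded
  obtain ⟨l, hl, -⟩ := hK
  obtain ⟨N, hN⟩ :=
    SelfIntegral.exists_randomMeasure_stochasticIntegral hG hZ hM hD hDm hl
  refine ⟨N, fun A hA hAD => ?_, fun A hA hAD => ?_, fun A B hA hAD hB hBD => ?_⟩
  -- Uniqueness of the limit needs at least one Riemann system of A; total boundedness supplies it.
  · have := SelfIntegral.neBot_fine hA (ht.subset hAD)
    have hb := hD.isBounded.subset hAD
    refine ⟨(SelfIntegral.isStochasticIntegral_iff hG hb).2 fun R =>
      (hN A hA hAD).1.comp R.tendsto_partition, fun I hI => ?_⟩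
    obtain ⟨R⟩ := SelfIntegral.nonempty_riemannSystem A
    exact tendsto_nhds_unique ((SelfIntegral.isStochasticIntegral_iff hG hb).1 hI R)
      ((hN A hA hAD).1.comp R.tendsto_partition)
  · refine ⟨SelfIntegral.selfIntegrable_of_subset hDm ht hl hA hAD, ?_⟩
    rw [(hN A hA hAD).2.1]
    exact SelfIntegral.isSelfIntegral_selfIntegral hDm ht hl hA hAD
  · have := SelfIntegral.neBot_fine hA (ht.subset hAD)
    have := SelfIntegral.neBot_fine hB (ht.subset hBD)
    obtain ⟨q, hq, hcov⟩ := (hN A hA hAD).2.2 B hB hBD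
    have hq2 : SelfIntegral.IsQuasiSelfIntegral
        (SelfIntegral.secondOrderKernel (SelfIntegral.crossCov Z M)) A B q := by
      refine SelfIntegral.isQuasiSelfIntegral_of_tendsto (hq.congr ?_)
      rintro ⟨p, p'⟩
      refine Finset.sum_congr rfl fun j _ => Finset.sum_congr rfl fun i _ => ?_
      -- The tags witness that the cells are nonempty, as the product formula on rectangles
      -- requires.
      exact (SelfIntegral.secondOrderKernel_prod _ _ _ (p.measurableSet_cell j)
        (p'.measurableSet_cell i) (hD.isBounded.subset ((p.cell_subset j).trans hAD))
        (hD.isBounded.subset ((p'.cell_subset i).trans hBD)) ⟨_, p.tag_mem j⟩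
        ⟨_, p'.tag_mem i⟩).symm
    exact ⟨q, hq2, fun q' hq' => hq'.unique hq2, hcov⟩
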